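/- Theorem 3.1. Let $\lambda\in C^1(\mathbb R;(0,+\infty))$, let $\bar\rho,k\in\mathbb R$, and put $d:=\bar\rho\,\lambda'(\bar\rho)/\lambda(\bar\rho)$. Consider the linear closed-loop system $$\rho_t(t,x)+\lambda(\bar\rho)\,\rho_x(t,x)=0\quad (t>0,\ 0<x<1),\qquad \rho(0,x)=\rho_0(x),\qquad u(t)=k\,y(t)+(k-1)\,d\,\lambda(\bar\rho)\,W(t),$$ where $u(t)=\lambda(\bar\rho)\rho(t,0)$, $y(t)=\lambda(\bar\rho)\rho(t,1)$ and $W(t)=\int_0^1\rho(t,x)\,dx$; that is, the boundary condition is $\rho(t,0)=k\rho(t,1)+(k-1)\,d\,W(t)$. A weak solution with initial datum $\rho_0\in L^2(0,1)$ is a function $\rho\in C^0([0,+\infty);L^2(0,1))$ for which there is an outflux $y$, belonging to $L^2(0,T)$ for every $T>0$, such that for every $\tau\ge 0$ and every $\varphi\in C^1([0,\tau]\times[0,1])$ with $\varphi(\tau,\cdot)=0$, $$-\int_0^\tau\!\!\int_0^1\rho\,(\varphi_t+\lambda(\bar\rho)\varphi_x)\,dx\,dt-\int_0^1\rho_0(x)\varphi(0,x)\,dx+\int_0^\tau\Big(y(t)\varphi(t,1)-\big[k\,y(t)+(k-1)\,d\,\lambda(\bar\rho)W(t)\big]\varphi(t,0)\Big)dt=0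 .$$ For every $\rho_0\in L^2(0,1)$ there is a unique weak solution. Moreover, $0$ is exponentially stable in $L^2(0,1)$ if and only if $d>-1$ and $|k|<1$. That is, $d>-1$ and $|k|<1$ hold if and only if there are constants $C>0$ and $\alpha>0$ (depending only on $\lambda,\bar\rho,k$) such that for every $\rho_0\in L^2(0,1)$ the weak solution satisfies $$\|\rho(t,\cdot)\|_{L^2(0,1)}\le C e^{-\alpha t}\|\rho_0\|_{L^2(0,1)}\qquad\text{for all } t\ge 0 .$$ -/

import Mathlib

open Set MeasureTheory

noncomputable section

namespace ReentrantFlow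

/-- The real Hilbert space `L²(0,1)`. -/
abbrev L2 : Type := Lp ℝ 2 (volume.restrict (Ioo (0 : ℝ) 1))

/-- The number `d = ρ̄ λ'(ρ̄) / λ(ρ̄)` attached to the velocity function `vel = λ` and the
equilibrium `rhobar = ρ̄`. -/
def dParam (vel : ℝ → ℝ) (rhobar : ℝ) : ℝ := rhobar * deriv vel rhobar / vel rhobar

/-- The total mass `∫₀¹ r(x) dx` of a profile `r ∈ L²(0,1)`. -/
def mass (r : L2) : ℝ := ∫ x in Ioo (0 : ℝ) 1, r x

/-- The weak form of the linearized closed-loop system, on the time interval `[0, τ]` and against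
the test function `φ (t, x)`, for the state `ρ`, the initial datum `ρ₀` and the outflux `y`.
The influx is `u(t) = k y(t) + (k - 1) d λ(ρ̄) W(t)` where `W(t)` is the mass of `ρ(t)`. -/
def WeakIdentity (vel : ℝ → ℝ) (rhobar k : ℝ) (ρ₀ : L2) (ρ : ℝ → L2) (y : ℝ → ℝ)
    (τ : ℝ) (φ : ℝ × ℝ → ℝ) : Prop :=
  - (∫ t in (0 : ℝ)..τ, ∫ x in Ioo (0 : ℝ) 1,
        (ρ t) x * (deriv (fun s => φ (s, x)) t + vel rhobar * deriv (fun z => φ (t, z)) x))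
    - (∫ x in Ioo (0 : ℝ) 1, ρ₀ x * φ (0, x))
    + (∫ t in (0 : ℝ)..τ,
        (y t * φ (t, 1)
          - (k * y t + (k - 1) * dParam vel rhobar * vel rhobar * mass (ρ t)) * φ (t, 0)))
    = 0

/-- `ρ ∈ C⁰([0,∞); L²(0,1))` is a weak solution of the linearized closed-loop system
* `ρ_t + λ(ρ̄) ρ_x = 0` on `(0,∞) × (0,1)`,
* `ρ(0,x) = ρ₀(x)`,
* `u(t) = k y(t) + (k - 1) d λ(ρ̄) W(t)`, where `u(t) = λ(ρ̄) ρ(t,0)`, `y(t) = λ(ρ̄) ρ(t,1)`,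
  `W(t) = ∫₀¹ ρ(t,x) dx`.

The outflux `y` belongs to `L²(0,T)` for every `T`. Because the test functions are
free at `x = 1`, the identity determines `y` as `λ(ρ̄)` times the trace of `ρ` at `x = 1`. The
`C¹` test functions on the rectangle `[0,τ] × [0,1]` are the restrictions of the `C¹` functions on
the plane. Only the values of `ρ` at times `t ≥ 0` matter. -/
structure IsWeakSolution (vel : ℝ → ℝ) (rhobar k : ℝ) (ρ₀ : L2) (ρ : ℝ → L2) : Prop where
  continuousOn : ContinuousOn ρ (Ici 0)
  weak : ∃ y : ℝ → ℝ,
    (∀ T : ℝ, 0 < T → MemLp y 2 (volume.restrict (Ioo 0 T))) ∧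
    ∀ τ : ℝ, 0 ≤ τ → ∀ φ : ℝ × ℝ → ℝ, ContDiff ℝ 1 φ →
      (∀ x ∈ Icc (0 : ℝ) 1, φ (τ, x) = 0) →
      WeakIdentity vel rhobar k ρ₀ ρ y τ φ

/-- Exponential stability of `0` in `L²(0,1)` for the linearized closed-loop system. -/
def ExponentiallyStable (vel : ℝ → ℝ) (rhobar k : ℝ) : Prop :=
  ∃ C : ℝ, 0 < C ∧ ∃ α : ℝ, 0 < α ∧
    ∀ (ρ₀ : L2) (ρ : ℝ → L2), IsWeakSolution vel rhobar k ρ₀ ρ →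
      ∀ t : ℝ, 0 ≤ t → ‖ρ t‖ ≤ C * Real.exp (-α * t) * ‖ρ₀‖

end ReentrantFlow

end

/-! Write `a` for the velocity at equilibrium and let `V` record the density at the inlet in the
time scale where the interval is crossed in one unit, so that `ρ(t,x) = V(a t + 1 - x)`. The values
of `V` on `[0,1]` are the reversed initial datum, and the boundary condition is the delay equation
`V(s+1) = k V(s) - c N(s)` with `c = (1-k) d` and `N(s) = ∫_s^{s+1} V`. As `N' = V(s+1) - V(s)`,
each transit maps `f`, the restriction of `V` to one unit interval, to an explicit `step c k f`, and
stability is a question about the powers of this map.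

Sufficiency. Put `g = f + d N`. Then `f = g - d N`, `step c k f = k g - d N` and `N' = (k-1) g`;
subtracting squares and integrating `2 N N'` shows that `‖f‖² + d (∫ f)²` drops by exactly `(1-k²)
‖g‖²` (`energy_step`). For `d > -1` Cauchy–Schwarz makes this energy equivalent to the norm, and `g`
determines `f` with a bound (`exists_normSq_le_dissipation`), so the energy decays geometrically.

Necessity. `N` depends on `f` only through its primitive, so if `|k| ≥ 1` a rapidly oscillating
cosine is almost multiplied by `k` over any prescribed number of transits. If `|k| < 1` and `d =
-1`, the constant `1` is fixed by `step`; if `d < -1`, its energy is negative and cannot increase,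
which keeps its norm away from zero.

Weak solutions. Existence is Fubini's theorem along characteristics (`integral_transport`). For
uniqueness, test functions `θ(t) η(x - a t)` yield a formula for `ρ(t)` paired with a transported
`η` (`pairing_weakSolution`). For zero data it forces the outflux to vanish during the first
transit; the mass then solves a homogeneous Volterra equation, so it vanishes and the state with it.
Induction over transits finishes. -/

noncomputable section

namespace ReentrantFlow

section

/-! ### Locally square integrable functions on the line -/

/-- `f` is square integrable on every bounded interval. -/
def LocallySquareIntegrable (f : ℝ → ℝ) : Prop :=
  ∀ a b : ℝ, MemLp f 2 (volume.restrict (Ioc a b))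

namespace LocallySquareIntegrable

variable {f g : ℝ → ℝ}

theorem of_continuous (hf : Continuous f) : LocallySquareIntegrable f := by
  intro a b
  obtain ⟨C, hC⟩ := isCompact_Icc.exists_bound_of_continuousOn (s := Icc a b) hf.continuousOn
  refine MemLp.of_bound hf.aestronglyMeasurable C ?_
  filter_upwards [ae_restrict_mem measurableSet_Ioc] with x hx
  exact hC x ⟨hx.1.le, hx.2⟩

theorem add (hf : LocallySquareIntegrable f) (hg : LocallySquareIntegrable g) :
    LocallySquareIntegrable (fun x => f x + g x) := fun a b => (hf a b).add (hg a b)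

theorem sub (hf : LocallySquareIntegrable f) (hg : LocallySquareIntegrable g) :
    LocallySquareIntegrable (fun x => f x - g x) := fun a b => (hf a b).sub (hg a b)

theorem const_mul (hf : LocallySquareIntegrable f) (r : ℝ) :
    LocallySquareIntegrable (fun x => r * f x) := fun a b => (hf a b).const_mul r

theorem intervalIntegrable (hf : LocallySquareIntegrable f) (a b : ℝ) :
    IntervalIntegrable f volume a b :=
  ⟨(hf a b).integrable one_le_two, (hf b a).integrable one_le_two⟩

theorem intervalIntegrable_mul (hf : LocallySquareIntegrable f) (hg : LocallySquareIntegrable g)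
    (a b : ℝ) : IntervalIntegrable (fun x => f x * g x) volume a b :=
  ⟨(hf a b).integrable_mul (hg a b), (hf b a).integrable_mul (hg b a)⟩

theorem intervalIntegrable_sq (hf : LocallySquareIntegrable f) (a b : ℝ) :
    IntervalIntegrable (fun x => f x ^ 2) volume a b := by
  simpa only [sq] using hf.intervalIntegrable_mul hf a b

/-- The square of the mean over the unit interval is at most the mean of the square. -/
theorem sq_integral_le (hf : LocallySquareIntegrable f) :
    (∫ x in (0 : ℝ)..1, f x) ^ 2 ≤ ∫ x in (0 : ℝ)..1, f x ^ 2 := by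
  set m := ∫ x in (0 : ℝ)..1, f x with hm
  -- The variance is nonnegative; expanding it gives the claim.
  have h1 : 0 ≤ ∫ x in (0 : ℝ)..1, (f x - m) ^ 2 :=
    intervalIntegral.integral_nonneg zero_le_one fun _ _ => sq_nonneg _
  have h2 : ∫ x in (0 : ℝ)..1, (f x - m) ^ 2
      = (∫ x in (0 : ℝ)..1, f x ^ 2) - 2 * m * (∫ x in (0 : ℝ)..1, f x) + m ^ 2 := by
    have : ∀ x, (f x - m) ^ 2 = f x ^ 2 - 2 * m * f x + m ^ 2 := fun x => by ring
    simp_rw [this]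
    rw [intervalIntegral.integral_add, intervalIntegral.integral_sub,
      intervalIntegral.integral_const_mul]
    · simp
    · exact hf.intervalIntegrable_sq 0 1
    · exact (hf.intervalIntegrable 0 1).const_mul _
    · exact (hf.intervalIntegrable_sq 0 1).sub ((hf.intervalIntegrable 0 1).const_mul _)
    · simp
  rw [h2, ← hm] at h1
  nlinarith

/-- A primitive is bounded on the unit interval by the `L²` norm. -/
theorem sq_primitive_le (hf : LocallySquareIntegrable f) {s : ℝ} (hs : s ∈ Icc (0 : ℝ) 1) :
    (∫ x in (0 : ℝ)..s, f x) ^ 2 ≤ ∫ x in (0 : ℝ)..1, f x ^ 2 := by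
  -- Cutting `f` off beyond `s` turns the primitive into an integral over the whole unit interval.
  have hind : LocallySquareIntegrable ((Iic s).indicator f) := fun a b =>
    (hf a b).indicator measurableSet_Iic
  have h1 : ∫ x in (0 : ℝ)..s, f x = ∫ x in (0 : ℝ)..1, (Iic s).indicator f x :=
    (intervalIntegral.integral_indicator hs).symm
  rw [h1]
  refine hind.sq_integral_le.trans ?_
  refine intervalIntegral.integral_mono_on zero_le_one (hind.intervalIntegrable_sq 0 1)
    (hf.intervalIntegrable_sq 0 1) fun x _ => ?_
  by_cases hx : x ∈ Iic s
  · rw [indicator_of_mem hx]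
  · rw [indicator_of_notMem hx]; simpa using sq_nonneg (f x)

end LocallySquareIntegrable

/-- The derivative of the square of an absolutely continuous function, in integrated form. -/
theorem integral_two_mul_mul_primitive {h : ℝ → ℝ} (hh : IntervalIntegrable h volume 0 1)
    {W : ℝ → ℝ} {w₀ : ℝ} (hW : ∀ s ∈ Icc (0 : ℝ) 1, W s = w₀ + ∫ x in (0 : ℝ)..s, h x) :
    ∫ s in (0 : ℝ)..1, 2 * W s * h s = W 1 ^ 2 - W 0 ^ 2 := by
  set G : ℝ → ℝ := fun s => ∫ x in (0 : ℝ)..s, h x with hG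
  have hac : AbsolutelyContinuousOnInterval G 0 1 :=
    hh.absolutelyContinuousOnInterval_intervalIntegral (by simp)
  have hid := hac.integral_deriv_mul_eq_sub hac
  have hG0 : G 0 = 0 := by simp [hG]
  have hcont : ContinuousOn G (uIcc 0 1) := hac.continuousOn
  have hint : IntervalIntegrable (fun s => 2 * G s * h s) volume 0 1 :=
    hh.continuousOn_mul (continuousOn_const.mul hcont)
  have h1 : ∫ s in (0 : ℝ)..1, 2 * G s * h s = G 1 ^ 2 := by
    have : ∫ s in (0 : ℝ)..1, 2 * G s * h s
        = ∫ s in (0 : ℝ)..1, deriv G s * G s + G s * deriv G s := by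
      refine intervalIntegral.integral_congr_ae ?_
      filter_upwards [hh.ae_hasDerivAt_integral] with x hx hx'
      rw [(hx (uIoc_subset_uIcc hx') 0 (by simp)).deriv]
      ring
    rw [this, hid, hG0]; ring
  have h2 : ∫ s in (0 : ℝ)..1, 2 * W s * h s
      = ∫ s in (0 : ℝ)..1, (2 * w₀ * h s + 2 * G s * h s) := by
    refine intervalIntegral.integral_congr fun s hs => ?_
    rw [uIcc_of_le zero_le_one] at hs
    simp only [hW s hs, hG]
    ring
  rw [h2, intervalIntegral.integral_add (hh.const_mul _) hint, h1,
    intervalIntegral.integral_const_mul, hW 1 (by simp), hW 0 (by simp)]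
  simp only [hG, intervalIntegral.integral_same]
  ring

/-- A continuous solution of a homogeneous linear Volterra equation vanishes. -/
theorem eq_zero_of_eq_mul_primitive {D : ℝ → ℝ} {κ T : ℝ} (hc : ContinuousOn D (Icc 0 T))
    (hD : ∀ t ∈ Icc (0 : ℝ) T, D t = κ * ∫ s in (0 : ℝ)..t, D s) :
    ∀ t ∈ Icc (0 : ℝ) T, D t = 0 := by
  intro t ht
  have hT : (0 : ℝ) ≤ T := ht.1.trans ht.2
  -- A continuous extension of `D` to the line makes its primitive differentiable everywhere, so
  -- that Grönwall's inequality applies to the primitive.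
  set E : ℝ → ℝ := IccExtend hT ((Icc 0 T).domRestrict D) with hE
  have hEc : Continuous E := (continuousOn_iff_continuous_domRestrict.1 hc).Icc_extend'
  have hED : ∀ s ∈ Icc (0 : ℝ) T, E s = D s := fun s hs => IccExtend_of_mem hT _ hs
  have hint : ∀ s ∈ Icc (0 : ℝ) T, ∫ x in (0 : ℝ)..s, D x = ∫ x in (0 : ℝ)..s, E x := by
    intro s hs
    refine intervalIntegral.integral_congr fun x hx => ?_
    rw [uIcc_of_le hs.1] at hx
    exact (hED x ⟨hx.1, hx.2.trans hs.2⟩).symm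
  have hder : ∀ s, HasDerivAt (fun s => ∫ x in (0 : ℝ)..s, E x) (E s) s := fun s =>
    hEc.integral_hasStrictDerivAt 0 s |>.hasDerivAt
  have key := eq_zero_of_abs_deriv_le_mul_abs_self_of_eq_zero_right
    (f := fun s => ∫ x in (0 : ℝ)..s, E x) (f' := E) (K := |κ|) (a := 0) (b := T)
    (fun s _ => (hder s).continuousAt.continuousWithinAt)
    (fun s _ => (hder s).hasDerivWithinAt) (by simp) (fun s hs => by
      have hs' : s ∈ Icc (0 : ℝ) T := ⟨hs.1, hs.2.le⟩
      rw [hED s hs', hD s hs', hint s hs', Real.norm_eq_abs, Real.norm_eq_abs, abs_mul])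
  rw [hD t ht, hint t ht, key t ht, mul_zero]

/-! ### One transit of the flow

In the time scale in which the flow crosses `(0, 1)` in one unit of time, `f : [0,1] → ℝ` is the
influx during one transit, and `step c k f` the influx during the next one; it obeys
`step c k f = k f - c N`, with `N = inFlightMass c k f` the mass present in the interval. -/

/-- The primitive of `f` vanishing at `0`. -/
def primitive (f : ℝ → ℝ) (s : ℝ) : ℝ := ∫ σ in (0 : ℝ)..s, f σ

/-- The mass in the interval during a transit, the solution of `N' = (k - 1) f - c N` with
`N(0) = ∫₀¹ f`, written without derivatives of the primitive of `f`. -/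
def inFlightMass (c k : ℝ) (f : ℝ → ℝ) (s : ℝ) : ℝ :=
  Real.exp (-c * s) *
    (primitive f 1 + c * (1 - k) * ∫ σ in (0 : ℝ)..s, Real.exp (c * σ) * primitive f σ)
    - (1 - k) * primitive f s

/-- The influx during the transit that follows the one with influx `f`. -/
def step (c k : ℝ) (f : ℝ → ℝ) (s : ℝ) : ℝ := k * f s - c * inFlightMass c k f s

variable {c k : ℝ} {f : ℝ → ℝ}

theorem continuous_primitive (hf : LocallySquareIntegrable f) : Continuous (primitive f) :=
  intervalIntegral.continuous_primitive (fun a b => hf.intervalIntegrable a b) 0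

theorem continuous_inFlightMass (hf : LocallySquareIntegrable f) :
    Continuous (inFlightMass c k f) := by
  have hF := continuous_primitive hf
  have h1 : Continuous fun s => ∫ σ in (0 : ℝ)..s, Real.exp (c * σ) * primitive f σ :=
    intervalIntegral.continuous_primitive
      (fun a b => (Continuous.intervalIntegrable (by fun_prop) a b)) 0
  unfold inFlightMass
  fun_prop

theorem LocallySquareIntegrable.step (hf : LocallySquareIntegrable f) :
    LocallySquareIntegrable (step c k f) :=
  (hf.const_mul k).sub ((of_continuous (continuous_inFlightMass hf)).const_mul c)

theorem inFlightMass_zero : inFlightMass c k f 0 = primitive f 1 := by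
  simp [inFlightMass, primitive]

/-- Since `f` is only square integrable, `N` need not be differentiable everywhere, but `Z = N +
(1-k) F`, with `F` the primitive of `f`, is, and `Z' = -c N`. Integrating this gives the equation
for `N` without differentiating `F`. -/
theorem inFlightMass_eq (hf : LocallySquareIntegrable f) (s : ℝ) :
    inFlightMass c k f s
      = primitive f 1 - (1 - k) * primitive f s - c * ∫ σ in (0 : ℝ)..s, inFlightMass c k f σ := by
  have hF := continuous_primitive hf
  set Z : ℝ → ℝ := fun s => Real.exp (-c * s) *
    (primitive f 1 + c * (1 - k) * ∫ σ in (0 : ℝ)..s, Real.exp (c * σ) * primitive f σ) with hZ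
  have hder : ∀ s, HasDerivAt Z (-c * inFlightMass c k f s) s := by
    intro s
    have h1 : HasDerivAt (fun s => ∫ σ in (0 : ℝ)..s, Real.exp (c * σ) * primitive f σ)
        (Real.exp (c * s) * primitive f s) s :=
      (Continuous.integral_hasStrictDerivAt (by fun_prop) 0 s).hasDerivAt
    have h2 : HasDerivAt (fun s => Real.exp (-c * s)) (Real.exp (-c * s) * (-c)) s := by
      simpa using ((hasDerivAt_id s).const_mul (-c)).exp
    refine (h2.mul ((h1.const_mul (c * (1 - k))).const_add (primitive f 1))).congr_deriv ?_
    have h3 : Real.exp (-c * s) * Real.exp (c * s) = 1 := by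
      rw [← Real.exp_add]; simp
    simp only [inFlightMass]
    linear_combination (c * (1 - k) * primitive f s) * h3
  have hcont := continuous_inFlightMass (c := c) (k := k) hf
  have := intervalIntegral.integral_eq_sub_of_hasDerivAt (f := Z) (a := 0) (b := s)
    (fun x _ => hder x) ((continuous_const.mul hcont).intervalIntegrable 0 s)
  rw [intervalIntegral.integral_const_mul] at this
  have hZ0 : Z 0 = primitive f 1 := by simp [hZ]
  have hs : inFlightMass c k f s = Z s - (1 - k) * primitive f s := rfl
  rw [hs]
  linarith

theorem primitive_step (hf : LocallySquareIntegrable f) (s : ℝ) :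
    primitive (step c k f) s
      = k * primitive f s - c * ∫ σ in (0 : ℝ)..s, inFlightMass c k f σ := by
  have hcont := continuous_inFlightMass (c := c) (k := k) hf
  unfold primitive step
  rw [intervalIntegral.integral_sub, intervalIntegral.integral_const_mul,
    intervalIntegral.integral_const_mul]
  · exact (hf.intervalIntegrable 0 s).const_mul k
  · exact (continuous_const.mul hcont).intervalIntegrable 0 s

/-- Conservation of mass. -/
theorem inFlightMass_eq_sub_add (hf : LocallySquareIntegrable f) (s : ℝ) :
    inFlightMass c k f s
      = primitive f 1 - primitive f s + primitive (step c k f) s := by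
  rw [primitive_step hf, inFlightMass_eq hf]
  ring

theorem inFlightMass_one (hf : LocallySquareIntegrable f) :
    inFlightMass c k f 1 = primitive (step c k f) 1 := by
  rw [inFlightMass_eq_sub_add hf]; ring

/-- A constant density stays in equilibrium when `k - c = 1`, which for `c = (1-k) d` covers the
borderline `d = -1`. -/
theorem step_const (c : ℝ) : step c (1 + c) (fun _ => 1) = fun _ => 1 := by
  funext s
  have hF : primitive (fun _ => 1) = fun s => s := by funext s; simp [primitive]
  -- The factor `c ^ 2` avoids division by `c`, so that `c = 0` is not a separate case.
  have hder : ∀ x, HasDerivAt (fun x => Real.exp (c * x) * (c * x - 1))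
      (c ^ 2 * (Real.exp (c * x) * x)) x := by
    intro x
    have h1 : HasDerivAt (fun x => c * x) c x := by simpa using (hasDerivAt_id x).const_mul c
    refine (h1.exp.mul (h1.sub_const 1)).congr_deriv ?_
    ring
  have hint := intervalIntegral.integral_eq_sub_of_hasDerivAt (a := 0) (b := s)
    (fun x _ => hder x) (Continuous.intervalIntegrable (by fun_prop) 0 s)
  rw [intervalIntegral.integral_const_mul] at hint
  have hexp : Real.exp (-c * s) * Real.exp (c * s) = 1 := by
    rw [← Real.exp_add]; simp
  simp only [mul_zero, Real.exp_zero] at hint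
  simp only [step, inFlightMass, hF]
  linear_combination c * Real.exp (-c * s) * hint + (c * (c * s - 1)) * hexp

theorem LocallySquareIntegrable.iterate_step (hf : LocallySquareIntegrable f) (n : ℕ) :
    LocallySquareIntegrable ((ReentrantFlow.step c k)^[n] f) := by
  induction n with
  | zero => exact hf
  | succ n ih => rw [Function.iterate_succ_apply']; exact ih.step

/-! ### The energy -/

/-- The square of the `L²(0,1)` norm. -/
def normSq (f : ℝ → ℝ) : ℝ := ∫ s in (0 : ℝ)..1, f s ^ 2

/-- The energy `‖f‖² + d (∫ f)²`. -/
def energy (d : ℝ) (f : ℝ → ℝ) : ℝ := normSq f + d * primitive f 1 ^ 2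

theorem normSq_nonneg (f : ℝ → ℝ) : 0 ≤ normSq f :=
  intervalIntegral.integral_nonneg zero_le_one fun _ _ => sq_nonneg _

/-- The cross term of `u² - f²` is `-d · 2 N N'`, an exact derivative. Its boundary values `N(0) = ∫
f` and `N(1) = ∫ u` account for the mass term of the energy. -/
theorem energy_step {d : ℝ} (hf : LocallySquareIntegrable f) :
    energy d (step ((1 - k) * d) k f)
      = energy d f - (1 - k ^ 2) * normSq (fun s => f s + d * inFlightMass ((1 - k) * d) k f s) := by
  set N := inFlightMass ((1 - k) * d) k f with hN
  set u := step ((1 - k) * d) k f with hu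
  have hNc : Continuous N := continuous_inFlightMass hf
  have hNl : LocallySquareIntegrable N := .of_continuous hNc
  have hul : LocallySquareIntegrable u := hf.step
  have hg : LocallySquareIntegrable (fun s => f s + d * N s) := hf.add (hNl.const_mul d)
  have hW : ∀ s ∈ Icc (0 : ℝ) 1, N s = primitive f 1 + ∫ x in (0 : ℝ)..s, (u x - f x) := by
    intro s _
    rw [hN, inFlightMass_eq_sub_add hf,
      intervalIntegral.integral_sub (hul.intervalIntegrable 0 s) (hf.intervalIntegrable 0 s)]
    simp only [primitive]
    ring
  have h1 := integral_two_mul_mul_primitive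
    ((hul.sub hf).intervalIntegrable 0 1) hW
  have hpt : ∀ s, u s ^ 2 = f s ^ 2 - d * (2 * N s * (u s - f s))
      - (1 - k ^ 2) * (f s + d * N s) ^ 2 := by
    intro s
    have : u s = k * f s - (1 - k) * d * N s := rfl
    rw [this]; ring
  have h3 : normSq u = normSq f - d * (N 1 ^ 2 - N 0 ^ 2)
      - (1 - k ^ 2) * normSq (fun s => f s + d * N s) := by
    unfold normSq
    rw [← h1]
    simp_rw [hpt]
    have i1 := hf.intervalIntegrable_sq 0 1
    have i2 : IntervalIntegrable (fun s => d * (2 * N s * (u s - f s))) volume 0 1 :=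
      ((hNl.const_mul 2).intervalIntegrable_mul (hul.sub hf) 0 1).const_mul d
    rw [intervalIntegral.integral_sub (i1.sub i2) ((hg.intervalIntegrable_sq 0 1).const_mul _),
      intervalIntegral.integral_sub i1 i2, intervalIntegral.integral_const_mul,
      intervalIntegral.integral_const_mul]
  have hN1 : N 1 = primitive u 1 := inFlightMass_one hf
  have hN0 : N 0 = primitive f 1 := inFlightMass_zero
  rw [hN1, hN0] at h3
  unfold energy
  linarith

end

section

variable {c k : ℝ} {f : ℝ → ℝ}

/-! ### Decay of the influx when `|k| < 1` and `d > -1` -/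

theorem intervalIntegral_unit_mono {f g : ℝ → ℝ} (hf : IntervalIntegrable f volume 0 1)
    (hg : IntervalIntegrable g volume 0 1) (h : ∀ s ∈ Icc (0 : ℝ) 1, f s ≤ g s) :
    ∫ s in (0 : ℝ)..1, f s ≤ ∫ s in (0 : ℝ)..1, g s :=
  intervalIntegral.integral_mono_on zero_le_one hf hg h

theorem normSq_add_le {f g : ℝ → ℝ} (hf : LocallySquareIntegrable f)
    (hg : LocallySquareIntegrable g) {B : ℝ} (hB : ∀ s ∈ Icc (0 : ℝ) 1, g s ^ 2 ≤ B) :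
    normSq (fun s => f s + g s) ≤ 2 * normSq f + 2 * B := by
  have h1 : normSq (fun s => f s + g s) ≤ ∫ s in (0 : ℝ)..1, (2 * f s ^ 2 + 2 * B) := by
    refine intervalIntegral_unit_mono ((hf.add hg).intervalIntegrable_sq 0 1)
      (((hf.intervalIntegrable_sq 0 1).const_mul 2).add (by simp)) fun s hs => ?_
    nlinarith [hB s hs, sq_nonneg (f s - g s)]
  refine h1.trans (le_of_eq ?_)
  rw [intervalIntegral.integral_add ((hf.intervalIntegrable_sq 0 1).const_mul 2) (by simp),
    intervalIntegral.integral_const_mul]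
  simp [normSq]

/-- Observability: the dissipation of the energy during one transit controls the norm. -/
theorem exists_normSq_le_dissipation {d : ℝ} (hd : -1 < d) (k : ℝ) :
    ∃ K : ℝ, 2 ≤ K ∧ ∀ f, LocallySquareIntegrable f →
      normSq f ≤ K * normSq (fun s => f s + d * inFlightMass ((1 - k) * d) k f s) := by
  have hd' : 0 < (1 + d) ^ 2 := by have : 0 < 1 + d := by linarith
                                   positivity
  refine ⟨2 * (1 + d ^ 2 / (1 + d) ^ 2) * (2 * (1 + (d * (1 - k)) ^ 2)), ?_, fun f hf => ?_⟩
  · have h1 : 1 ≤ 1 + d ^ 2 / (1 + d) ^ 2 := by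
      have : 0 ≤ d ^ 2 / (1 + d) ^ 2 := by positivity
      linarith
    have h2 : 1 ≤ 1 + (d * (1 - k)) ^ 2 := by nlinarith [sq_nonneg (d * (1 - k))]
    nlinarith
  set N := inFlightMass ((1 - k) * d) k f with hN
  have hNl : LocallySquareIntegrable N := .of_continuous (continuous_inFlightMass hf)
  set g : ℝ → ℝ := fun s => f s + d * N s with hg
  have hgl : LocallySquareIntegrable g := hf.add (hNl.const_mul d)
  have hGl : LocallySquareIntegrable (fun s => d * (1 - k) * primitive g s) :=
    (LocallySquareIntegrable.of_continuous (continuous_primitive hgl)).const_mul _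
  -- Since `N' = (k-1) g` and `N(0) = w`, the function `f = g - d N` equals `e - d w` with `e` built
  -- from `g` alone. Integrating over the unit interval gives `(1+d) w = ∫ e`; this is where `d ≠
  -- -1` enters.
  set e : ℝ → ℝ := fun s => g s + d * (1 - k) * primitive g s with he
  have hel : LocallySquareIntegrable e := hgl.add hGl
  set w := primitive f 1 with hw
  have hG : ∀ s, primitive g s = primitive f s + d * ∫ σ in (0 : ℝ)..s, N σ := by
    intro s
    simp only [primitive, hg]
    rw [intervalIntegral.integral_add (hf.intervalIntegrable 0 s)
      ((hNl.intervalIntegrable 0 s).const_mul d), intervalIntegral.integral_const_mul]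
  have hNG : ∀ s, N s = w - (1 - k) * primitive g s := by
    intro s
    rw [hN, inFlightMass_eq hf, hG]; ring
  have hfe : ∀ s, f s = e s + -(d * w) := by
    intro s
    simp only [he, hg]
    linear_combination (-d) * hNG s
  have he2 : normSq e ≤ 2 * (1 + (d * (1 - k)) ^ 2) * normSq g := by
    refine (normSq_add_le hgl hGl (B := (d * (1 - k)) ^ 2 * normSq g) fun s hs => ?_).trans
      (le_of_eq (by ring))
    rw [mul_pow]
    exact mul_le_mul_of_nonneg_left (hgl.sq_primitive_le hs) (sq_nonneg _)
  have hw1 : (1 + d) * w = ∫ s in (0 : ℝ)..1, e s := by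
    have : w = ∫ s in (0 : ℝ)..1, (e s + -(d * w)) := by
      rw [hw, primitive]
      exact intervalIntegral.integral_congr fun s _ => hfe s
    rw [intervalIntegral.integral_add (hel.intervalIntegrable 0 1) (by simp)] at this
    simp at this
    linarith
  have hw2 : w ^ 2 ≤ normSq e / (1 + d) ^ 2 := by
    rw [le_div_iff₀ hd', ← mul_pow, mul_comm, hw1]
    exact hel.sq_integral_le
  have hf2 : normSq f ≤ 2 * normSq e + 2 * (d ^ 2 * (normSq e / (1 + d) ^ 2)) := by
    have : normSq f = normSq (fun s => e s + -(d * w)) := by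
      congr 1; funext s; exact hfe s
    rw [this]
    refine normSq_add_le hel (.of_continuous continuous_const) fun s _ => ?_
    rw [neg_sq, mul_pow]
    exact mul_le_mul_of_nonneg_left hw2 (sq_nonneg d)
  calc normSq f ≤ 2 * (1 + d ^ 2 / (1 + d) ^ 2) * normSq e := by
        refine hf2.trans (le_of_eq ?_); ring
    _ ≤ 2 * (1 + d ^ 2 / (1 + d) ^ 2) * (2 * (1 + (d * (1 - k)) ^ 2) * normSq g) := by
        gcongr
    _ = _ := by ring

theorem sq_primitive_one_le (hf : LocallySquareIntegrable f) : primitive f 1 ^ 2 ≤ normSq f :=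
  hf.sq_integral_le

theorem energy_le {d : ℝ} (hf : LocallySquareIntegrable f) :
    energy d f ≤ (1 + |d|) * normSq f := by
  have h1 := sq_primitive_one_le hf
  have h2 : d * primitive f 1 ^ 2 ≤ |d| * normSq f :=
    mul_le_mul (le_abs_self d) h1 (sq_nonneg _) (abs_nonneg d)
  unfold energy
  linarith

/-- For negative `d` the mass term is at worst `d ‖f‖²`, by Cauchy–Schwarz. The bound is coercive
exactly when `d > -1`. -/
theorem min_mul_normSq_le_energy {d : ℝ} (hf : LocallySquareIntegrable f) :
    min 1 (1 + d) * normSq f ≤ energy d f := by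
  have h1 := sq_primitive_one_le hf
  have h0 := normSq_nonneg f
  unfold energy
  rcases le_total 0 d with hd | hd
  · have : min 1 (1 + d) = 1 := min_eq_left (by linarith)
    rw [this]
    nlinarith [sq_nonneg (primitive f 1), mul_nonneg hd (sq_nonneg (primitive f 1))]
  · have : min 1 (1 + d) = 1 + d := min_eq_right (by linarith)
    rw [this]
    nlinarith

/-- Geometric decay of the influx from transit to transit. -/
theorem exists_normSq_iterate_step_le {d : ℝ} (hd : -1 < d) (hk : |k| < 1) :
    ∃ C q : ℝ, 0 < C ∧ 0 < q ∧ q < 1 ∧ ∀ f, LocallySquareIntegrable f → ∀ n : ℕ,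
      normSq ((step ((1 - k) * d) k)^[n] f) ≤ C * q ^ n * normSq f := by
  obtain ⟨K, hK, hobs⟩ := exists_normSq_le_dissipation hd k
  have hk2 : 0 < 1 - k ^ 2 := by
    have := (sq_lt_one_iff_abs_lt_one k).2 hk
    linarith
  have hm : 0 < min 1 (1 + d) := lt_min one_pos (by linarith)
  have hD : 1 ≤ 1 + |d| := by linarith [abs_nonneg d]
  have hKD : 2 ≤ K * (1 + |d|) := by nlinarith
  -- The dissipation is at least `(1-k²)/K` times `‖f‖²`, and the energy is at most `(1+|d|) ‖f‖²`.
  -- The requirement `2 ≤ K` makes the ratio `1 - δ` positive.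
  set δ := (1 - k ^ 2) / (K * (1 + |d|)) with hδ
  have hδ0 : 0 < δ := by positivity
  have hδ1 : δ < 1 := by
    rw [hδ, div_lt_one (by positivity)]
    nlinarith [sq_nonneg k]
  have hstep : ∀ f, LocallySquareIntegrable f →
      energy d (step ((1 - k) * d) k f) ≤ (1 - δ) * energy d f := by
    intro f hf
    rw [energy_step hf]
    set D := normSq (fun s => f s + d * inFlightMass ((1 - k) * d) k f s)
    have h1 : energy d f ≤ (1 + |d|) * (K * D) :=
      (energy_le hf).trans (mul_le_mul_of_nonneg_left (hobs f hf) (by positivity))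
    have h2 : δ * energy d f ≤ (1 - k ^ 2) * D := by
      calc δ * energy d f ≤ δ * ((1 + |d|) * (K * D)) :=
            mul_le_mul_of_nonneg_left h1 hδ0.le
        _ = (1 - k ^ 2) * D := by
            rw [hδ]; field_simp
    linarith
  have hiter : ∀ f, LocallySquareIntegrable f → ∀ n : ℕ,
      energy d ((step ((1 - k) * d) k)^[n] f) ≤ (1 - δ) ^ n * energy d f := by
    intro f hf n
    induction n with
    | zero => simp
    | succ n ih =>
      rw [Function.iterate_succ_apply']
      refine (hstep _ (hf.iterate_step n)).trans ?_
      rw [pow_succ', mul_assoc]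
      exact mul_le_mul_of_nonneg_left ih (by linarith)
  refine ⟨(1 + |d|) / min 1 (1 + d), 1 - δ, by positivity, by linarith, by linarith,
    fun f hf n => ?_⟩
  have h1 := min_mul_normSq_le_energy (d := d) (hf.iterate_step (c := (1 - k) * d) (k := k) n)
  have h2 : (1 - δ) ^ n * energy d f ≤ (1 - δ) ^ n * ((1 + |d|) * normSq f) :=
    mul_le_mul_of_nonneg_left (energy_le hf) (pow_nonneg (by linarith) n)
  have h3 := h1.trans ((hiter f hf n).trans h2)
  rw [div_mul_eq_mul_div, div_mul_eq_mul_div, le_div_iff₀ hm]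
  linarith

/-! ### Absence of uniform decay in the other cases -/

/-- The formula for `N` involves `f` only through its primitive, so an oscillating `f` of large norm
can still have a small in-flight mass. -/
theorem exists_abs_inFlightMass_le (c k : ℝ) :
    ∃ M : ℝ, 0 ≤ M ∧ ∀ (f : ℝ → ℝ) (ε : ℝ), LocallySquareIntegrable f →
      (∀ s ∈ Icc (0 : ℝ) 1, |primitive f s| ≤ ε) →
      ∀ s ∈ Icc (0 : ℝ) 1, |inFlightMass c k f s| ≤ M * ε := by
  set X := Real.exp |c| with hX
  refine ⟨X * (1 + |c * (1 - k)| * X) + |1 - k|, by positivity, fun f ε hf hε s hs => ?_⟩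
  have hε0 : 0 ≤ ε := (abs_nonneg _).trans (hε 0 (by simp))
  have hexp : ∀ r : ℝ, |r| = |c| → ∀ t ∈ Icc (0 : ℝ) 1, |Real.exp (r * t)| ≤ X := by
    intro r hr t ht
    rw [Real.abs_exp, hX, Real.exp_le_exp, ← hr]
    calc r * t ≤ |r| * t := mul_le_mul_of_nonneg_right (le_abs_self r) ht.1
      _ ≤ |r| := mul_le_of_le_one_right (abs_nonneg r) ht.2
  have hI : |∫ σ in (0 : ℝ)..s, Real.exp (c * σ) * primitive f σ| ≤ X * ε := by
    have := intervalIntegral.norm_integral_le_of_norm_le_const (a := 0) (b := s)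
      (C := X * ε) (f := fun σ => Real.exp (c * σ) * primitive f σ) fun σ hσ => by
        rw [uIoc_of_le hs.1] at hσ
        have hσ' : σ ∈ Icc (0 : ℝ) 1 := ⟨hσ.1.le, hσ.2.trans hs.2⟩
        rw [norm_mul]
        exact mul_le_mul (hexp c rfl σ hσ') (hε σ hσ') (norm_nonneg _) (by positivity)
    rw [Real.norm_eq_abs, sub_zero, abs_of_nonneg hs.1] at this
    exact this.trans (mul_le_of_le_one_right (by positivity) hs.2)
  unfold inFlightMass
  set I := ∫ σ in (0 : ℝ)..s, Real.exp (c * σ) * primitive f σ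
  calc _ ≤ |Real.exp (-c * s)| * (|primitive f 1| + |c * (1 - k)| * |I|)
          + |1 - k| * |primitive f s| := by
        refine (abs_sub _ _).trans ?_
        rw [abs_mul, abs_mul (1 - k)]
        gcongr
        refine (abs_add_le _ _).trans ?_
        rw [abs_mul (c * (1 - k))]
    _ ≤ X * (ε + |c * (1 - k)| * (X * ε)) + |1 - k| * ε := by
        gcongr
        · exact hexp (-c) (abs_neg c) s hs
        · exact hε 1 (by simp)
        · exact hε s hs
    _ = _ := by ring

/-- Weakly small influxes are multiplied by `k` during one transit, up to a small error. -/
theorem exists_normSq_step_ge (c : ℝ) (hk : 1 ≤ |k|) :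
    ∃ K A : ℝ, 0 ≤ K ∧ 1 ≤ A ∧ ∀ (f : ℝ → ℝ) (ε : ℝ), LocallySquareIntegrable f →
      (∀ s ∈ Icc (0 : ℝ) 1, |primitive f s| ≤ ε) →
      (1 - K * ε) * (1 + normSq f) ≤ 1 + normSq (step c k f) ∧
      ∀ s ∈ Icc (0 : ℝ) 1, |primitive (step c k f) s| ≤ A * ε := by
  obtain ⟨M, hM, hbd⟩ := exists_abs_inFlightMass_le c k
  refine ⟨2 * |k * c| * M, 1 + |k| + |c| * M, by positivity, ?_, fun f ε hf hε => ⟨?_, ?_⟩⟩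
  · have : 0 ≤ |c| * M := by positivity
    linarith [abs_nonneg k]
  · have hε0 : 0 ≤ ε := (abs_nonneg _).trans (hε 0 (by simp))
    have hk2 : 1 ≤ k ^ 2 := (one_le_sq_iff_one_le_abs k).2 hk
    set B := 2 * |k * c| * M * ε with hB
    have hB0 : 0 ≤ B := by positivity
    have hpt : ∀ s ∈ Icc (0 : ℝ) 1, (1 - B) * f s ^ 2 + -B ≤ step c k f s ^ 2 := by
      intro s hs
      -- The cross term `2 k c f N` is absorbed through `|f| ≤ 1 + f²`, which is why `1 + normSq` is
      -- the quantity tracked.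
      have hN := hbd f ε hf hε s hs
      set N := inFlightMass c k f s
      have h1 : step c k f s ^ 2 = k ^ 2 * f s ^ 2 - 2 * (k * c) * (f s * N) + c ^ 2 * N ^ 2 := by
        simp only [step]; ring
      have h2 : 2 * (k * c) * (f s * N) ≤ B * (1 + f s ^ 2) := by
        have h3 : |f s| ≤ 1 + f s ^ 2 := by
          nlinarith [sq_abs (f s), sq_nonneg (|f s| - 1), abs_nonneg (f s)]
        calc 2 * (k * c) * (f s * N) ≤ |2 * (k * c) * (f s * N)| := le_abs_self _
          _ = 2 * |k * c| * (|f s| * |N|) := by rw [abs_mul, abs_mul, abs_mul (f s), abs_two]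
          _ ≤ 2 * |k * c| * ((1 + f s ^ 2) * (M * ε)) := by gcongr
          _ = B * (1 + f s ^ 2) := by rw [hB]; ring
      nlinarith [mul_nonneg (sq_nonneg c) (sq_nonneg N),
        mul_le_mul_of_nonneg_right hk2 (sq_nonneg (f s))]
    have hi := (hf.intervalIntegrable_sq 0 1).const_mul (1 - B)
    have h4 := intervalIntegral_unit_mono (hi.add (by simp))
      ((hf.step (c := c) (k := k)).intervalIntegrable_sq 0 1) hpt
    rw [intervalIntegral.integral_add hi (by simp), intervalIntegral.integral_const_mul] at h4
    simp only [intervalIntegral.integral_const, sub_zero, one_smul] at h4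
    have h5 : (1 - B) * normSq f + -B ≤ normSq (step c k f) := h4
    linarith
  · intro s hs
    have hε0 : 0 ≤ ε := (abs_nonneg _).trans (hε 0 (by simp))
    rw [primitive_step hf]
    have hI : |∫ σ in (0 : ℝ)..s, inFlightMass c k f σ| ≤ M * ε := by
      have := intervalIntegral.norm_integral_le_of_norm_le_const (a := 0) (b := s)
        (C := M * ε) (f := inFlightMass c k f) fun σ hσ => by
          rw [uIoc_of_le hs.1] at hσ
          exact hbd f ε hf hε σ ⟨hσ.1.le, hσ.2.trans hs.2⟩
      rw [Real.norm_eq_abs, sub_zero, abs_of_nonneg hs.1] at this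
      exact this.trans (mul_le_of_le_one_right (by positivity) hs.2)
    calc _ ≤ |k| * |primitive f s| + |c| * |∫ σ in (0 : ℝ)..s, inFlightMass c k f σ| := by
          refine (abs_sub _ _).trans ?_
          rw [abs_mul, abs_mul]
      _ ≤ |k| * ε + |c| * (M * ε) := by
          gcongr
          exact hε s hs
      _ ≤ (1 + |k| + |c| * M) * ε := by nlinarith

/-- The bound on the primitive grows by at most `A` per transit, so the worst loss, the factor `1 -
K A^n ε`, serves for all `n` transits. `hn` keeps this factor nonnegative. -/
theorem normSq_iterate_step_ge {K A : ℝ} (hA : 1 ≤ A) (hK : 0 ≤ K)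
    (h : ∀ (f : ℝ → ℝ) (ε : ℝ), LocallySquareIntegrable f →
      (∀ s ∈ Icc (0 : ℝ) 1, |primitive f s| ≤ ε) →
      (1 - K * ε) * (1 + normSq f) ≤ 1 + normSq (step c k f) ∧
      ∀ s ∈ Icc (0 : ℝ) 1, |primitive (step c k f) s| ≤ A * ε)
    {f : ℝ → ℝ} {ε : ℝ} (hf : LocallySquareIntegrable f)
    (hε : ∀ s ∈ Icc (0 : ℝ) 1, |primitive f s| ≤ ε) (n : ℕ) (hn : K * (A ^ n * ε) ≤ 1) :
    (1 - K * (A ^ n * ε)) ^ n * (1 + normSq f) ≤ 1 + normSq ((step c k)^[n] f) := by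
  have hε0 : 0 ≤ ε := (abs_nonneg _).trans (hε 0 (by simp))
  have key : ∀ m ≤ n, (∀ s ∈ Icc (0 : ℝ) 1, |primitive ((step c k)^[m] f) s| ≤ A ^ m * ε) ∧
      (1 - K * (A ^ n * ε)) ^ m * (1 + normSq f) ≤ 1 + normSq ((step c k)^[m] f) := by
    intro m
    induction m with
    | zero => intro _; simpa using hε
    | succ m ih =>
      intro hm
      obtain ⟨h1, h2⟩ := ih (by omega)
      obtain ⟨h3, h4⟩ := h _ _ (hf.iterate_step m) h1
      rw [Function.iterate_succ_apply']
      refine ⟨fun s hs => (h4 s hs).trans (le_of_eq (by ring)), le_trans ?_ h3⟩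
      have h5 : K * (A ^ m * ε) ≤ K * (A ^ n * ε) := by
        gcongr
        omega
      rw [pow_succ', mul_assoc]
      have h6 := normSq_nonneg ((step c k)^[m] f)
      exact mul_le_mul (by linarith) h2 (mul_nonneg (pow_nonneg (by linarith) m)
        (by linarith [normSq_nonneg f])) (by linarith)
  exact (key n le_rfl).2

theorem normSq_cos {j : ℕ} (hj : j ≠ 0) :
    normSq (fun s => Real.cos (2 * Real.pi * j * s)) = 1 / 2 := by
  have hw : 2 * Real.pi * j ≠ 0 := by positivity
  unfold normSq
  rw [intervalIntegral.integral_comp_mul_left (fun x => Real.cos x ^ 2) hw, integral_cos_sq]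
  have : Real.sin (2 * Real.pi * j * 1) = 0 := by
    rw [Real.sin_eq_zero_iff]; exact ⟨2 * j, by push_cast; ring⟩
  rw [this]
  simp
  field_simp

theorem abs_primitive_cos_le {j : ℕ} (hj : j ≠ 0) (s : ℝ) :
    |primitive (fun s => Real.cos (2 * Real.pi * j * s)) s| ≤ 1 / j := by
  have hw : 2 * Real.pi * j ≠ 0 := by positivity
  have hj' : (0 : ℝ) < j := by positivity
  unfold primitive
  rw [intervalIntegral.integral_comp_mul_left Real.cos hw, integral_cos]
  simp only [mul_zero, Real.sin_zero, sub_zero, smul_eq_mul, abs_mul]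
  rw [abs_of_pos (by positivity : 0 < (2 * Real.pi * j)⁻¹), inv_mul_eq_div]
  refine div_le_div₀ zero_le_one (Real.abs_sin_le_one _) hj' ?_
  nlinarith [Real.pi_gt_three]

theorem exists_normSq_iterate_step_ge_of_one_le_abs (c : ℝ) (hk : 1 ≤ |k|) (n : ℕ) :
    ∃ f, Continuous f ∧ normSq f ≤ 1 ∧ 1 / 4 ≤ normSq ((step c k)^[n] f) := by
  obtain ⟨K, A, hK, hA, h⟩ := exists_normSq_step_ge c hk
  -- With `n` fixed and the frequency `j` tending to infinity, the lower bound for `1 + normSq`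
  -- tends to `3/2`, so it eventually exceeds `5/4`.
  have hlim : Filter.Tendsto (fun j : ℕ => K * (A ^ n * (1 / (j : ℝ)))) Filter.atTop (nhds 0) := by
    simpa using (tendsto_one_div_atTop_nhds_zero_nat.const_mul (A ^ n)).const_mul K
  have hlim2 : Filter.Tendsto
      (fun j : ℕ => (1 - K * (A ^ n * (1 / (j : ℝ)))) ^ n * (1 + 1 / 2)) Filter.atTop
      (nhds ((1 - 0) ^ n * (1 + 1 / 2))) :=
    ((hlim.const_sub 1).pow n).mul_const _
  obtain ⟨j, hj1, hj2, hj3⟩ := ((hlim.eventually_le_const (zero_lt_one)).and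
    ((hlim2.eventually_const_le (u := 5 / 4) (by norm_num)).and
      (Filter.eventually_ne_atTop 0))).exists
  have hc : Continuous fun s => Real.cos (2 * Real.pi * j * s) := by fun_prop
  refine ⟨_, hc, by rw [normSq_cos hj3]; norm_num, ?_⟩
  have := normSq_iterate_step_ge hA hK h (.of_continuous hc)
    (fun s _ => abs_primitive_cos_le hj3 s) n hj1
  rw [normSq_cos hj3] at this
  linarith

/-- Without `|k| < 1` and `d > -1`, the influx does not decay uniformly. -/
theorem exists_normSq_iterate_step_ge {d : ℝ} (h : ¬ (-1 < d ∧ |k| < 1)) :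
    ∃ r : ℝ, 0 < r ∧ ∀ n : ℕ, ∃ f, Continuous f ∧ normSq f ≤ 1 ∧
      r ≤ normSq ((step ((1 - k) * d) k)^[n] f) := by
  rcases le_or_gt 1 |k| with hk | hk
  · exact ⟨1 / 4, by norm_num, exists_normSq_iterate_step_ge_of_one_le_abs _ hk⟩
  have hd : d ≤ -1 := not_lt.1 fun hd => h ⟨hd, hk⟩
  have hone : normSq (fun _ => 1) = 1 := by simp [normSq]
  have hl : LocallySquareIntegrable (fun _ => (1 : ℝ)) := .of_continuous continuous_const
  rcases hd.eq_or_lt with rfl | hd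
  · refine ⟨1, one_pos, fun n => ⟨fun _ => 1, continuous_const, hone.le, ?_⟩⟩
    have h1 : step ((1 - k) * -1) k (fun _ => 1) = fun _ => 1 := by
      have := step_const (k - 1)
      rwa [show 1 + (k - 1) = k by ring, show k - 1 = (1 - k) * -1 by ring] at this
    rw [Function.iterate_fixed h1, hone]
  · have hk2 : 0 ≤ 1 - k ^ 2 := by
      have := (sq_lt_one_iff_abs_lt_one k).2 hk
      linarith
    have hE : ∀ n, energy d ((step ((1 - k) * d) k)^[n] fun _ => 1) ≤ 1 + d := by
      intro n
      induction n with
      | zero => simp [energy, hone, primitive]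
      | succ n ih =>
        rw [Function.iterate_succ_apply', energy_step (hl.iterate_step n)]
        have := mul_nonneg hk2 (normSq_nonneg fun s =>
          ((step ((1 - k) * d) k)^[n] fun _ => 1) s + d * inFlightMass ((1 - k) * d) k
            ((step ((1 - k) * d) k)^[n] fun _ => 1) s)
        linarith
    -- From `‖f‖² + d (∫ f)² ≤ 1 + d`, `d < 0` and `(∫ f)² ≤ ‖f‖²` it follows that `(1+d) ‖f‖² ≤ 1 +
    -- d`, hence `d ‖f‖² ≤ 1 + d`.
    refine ⟨(1 + d) / d, div_pos_of_neg_of_neg (by linarith) (by linarith), fun n =>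
      ⟨fun _ => 1, continuous_const, hone.le, ?_⟩⟩
    have h1 := hE n
    have h2 := sq_primitive_one_le (hl.iterate_step (c := (1 - k) * d) (k := k) n)
    have h3 := normSq_nonneg ((step ((1 - k) * d) k)^[n] fun _ => 1)
    unfold energy at h1
    rw [div_le_iff_of_neg (by linarith)]
    nlinarith

end

section

variable {c k : ℝ} {f : ℝ → ℝ}

/-! ### Measurability and affine changes of variable -/

namespace LocallySquareIntegrable

theorem aestronglyMeasurable (hf : LocallySquareIntegrable f) :
    AEStronglyMeasurable f volume := by
  have h : ∀ n : ℕ, AEStronglyMeasurable f (volume.restrict (Ioc (-(n : ℝ)) n)) := fun n =>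
    (hf (-n) n).aestronglyMeasurable
  have hU : (⋃ n : ℕ, Ioc (-(n : ℝ)) n) = univ := by
    refine eq_univ_of_forall fun x => mem_iUnion.2 ?_
    obtain ⟨n, hn⟩ := exists_nat_gt |x|
    exact ⟨n, (abs_lt.1 hn).1, (abs_lt.1 hn).2.le⟩
  rw [← Measure.restrict_univ (μ := (volume : Measure ℝ)), ← hU]
  exact aestronglyMeasurable_iUnion_iff.2 h

theorem of_intervalIntegrable_sq (hm : AEStronglyMeasurable f volume)
    (hi : ∀ a b, IntervalIntegrable (fun x => f x ^ 2) volume a b) :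
    LocallySquareIntegrable f := by
  intro a b
  exact (memLp_two_iff_integrable_sq hm.restrict).2 (hi a b).1

theorem comp_affine (hf : LocallySquareIntegrable f) {m : ℝ} (hm : m ≠ 0) (r : ℝ) :
    LocallySquareIntegrable (fun x => f (m * x + r)) := by
  have hq : Measure.QuasiMeasurePreserving (fun x : ℝ => m * x + r) volume volume :=
    (measurePreserving_add_right volume r).quasiMeasurePreserving.comp
      (Measure.quasiMeasurePreserving_smul volume hm)
  refine of_intervalIntegrable_sq (hf.aestronglyMeasurable.comp_quasiMeasurePreserving hq)
    fun a b => ?_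
  have h1 := (hf.intervalIntegrable_sq (m * a + r) (m * b + r)).comp_add_right r
  have h2 := h1.comp_mul_left (c := m)
  simpa [hm] using h2

theorem comp_sub_right (hf : LocallySquareIntegrable f) (r : ℝ) :
    LocallySquareIntegrable (fun x => f (x - r)) := by
  simpa [sub_eq_add_neg] using hf.comp_affine one_ne_zero (-r)

theorem comp_sub_left (hf : LocallySquareIntegrable f) (r : ℝ) :
    LocallySquareIntegrable (fun x => f (r - x)) := by
  simpa [sub_eq_neg_add] using hf.comp_affine (m := -1) (by norm_num) r

theorem memLp_Ioo (hf : LocallySquareIntegrable f) (a b : ℝ) :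
    MemLp f 2 (volume.restrict (Ioo a b)) :=
  (hf a b).mono_measure (Measure.restrict_mono Ioo_subset_Ioc_self le_rfl)

end LocallySquareIntegrable

/-! ### The history of the influx -/

/-- The influx as a function of time, when the flow crosses the interval in one unit of time:
on `[n, n+1)` it is the translate of the `n`-th iterate of `step`. -/
def history (c k : ℝ) (f : ℝ → ℝ) (t : ℝ) : ℝ := (step c k)^[⌊t⌋₊] f (t - ⌊t⌋₊)

theorem history_eq (n : ℕ) {t : ℝ} (ht : t ∈ Ico (n : ℝ) (n + 1)) :
    history c k f t = (step c k)^[n] f (t - n) := by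
  have : ⌊t⌋₊ = n := (Nat.floor_eq_iff (n.cast_nonneg.trans ht.1)).2 ht
  rw [history, this]

theorem history_of_lt_one {t : ℝ} (ht : t < 1) : history c k f t = f t := by
  have : ⌊t⌋₊ = 0 := Nat.floor_eq_zero.2 ht
  simp [history, this]

/-- Induction adds one transit at a time. The base case contains all negative times, where the
natural floor is `0` and the history is `f` itself. -/
theorem intervalIntegrable_sq_history (hf : LocallySquareIntegrable f) (n : ℕ) (a : ℝ) :
    IntegrableOn (fun t => history c k f t ^ 2) (Iio (n : ℝ) ∩ Ioi a) ∧
      AEStronglyMeasurable (history c k f) (volume.restrict (Iio (n : ℝ) ∩ Ioi a)) := by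
  induction n with
  | zero =>
    have hs : Iio ((0 : ℕ) : ℝ) ∩ Ioi a ⊆ Ioc a 0 := fun x hx => ⟨hx.2, (show x < 0 by simpa using hx.1).le⟩
    have hms : MeasurableSet (Iio ((0 : ℕ) : ℝ) ∩ Ioi a) := measurableSet_Iio.inter measurableSet_Ioi
    have heq : ∀ x ∈ Iio ((0 : ℕ) : ℝ) ∩ Ioi a, f x = history c k f x := fun x hx => by
      have : x < 0 := by simpa using hx.1
      rw [history_of_lt_one (by linarith)]
    refine ⟨?_, ?_⟩
    · refine IntegrableOn.congr_fun (f := fun x => f x ^ 2)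
        ((hf.intervalIntegrable_sq a 0).1.mono_set hs) (fun x hx => ?_) hms
      simp only [heq x hx]
    · refine hf.aestronglyMeasurable.restrict.congr ?_
      filter_upwards [ae_restrict_mem hms] with x hx using heq x hx
  | succ n ih =>
    have hg := (hf.iterate_step (c := c) (k := k) n).comp_sub_right n
    have heq : ∀ x ∈ Ico (n : ℝ) (n + 1),
        ((step c k)^[n] f) (x - n) = history c k f x := fun x hx => (history_eq n hx).symm
    have h1 : IntegrableOn (fun t => history c k f t ^ 2) (Ico (n : ℝ) (n + 1)) := by
      refine IntegrableOn.congr_fun (f := fun x => ((step c k)^[n] f) (x - n) ^ 2)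
        ?_ (fun x hx => ?_) measurableSet_Ico
      · exact (hg.intervalIntegrable_sq n (n + 1)).1.congr_set_ae Ico_ae_eq_Ioc
      · simp only [heq x hx]
    have h2 : AEStronglyMeasurable (history c k f) (volume.restrict (Ico (n : ℝ) (n + 1))) := by
      refine hg.aestronglyMeasurable.restrict.congr ?_
      filter_upwards [ae_restrict_mem measurableSet_Ico] with x hx using heq x hx
    have hsub : Iio ((n + 1 : ℕ) : ℝ) ∩ Ioi a ⊆ (Iio (n : ℝ) ∩ Ioi a) ∪ Ico (n : ℝ) (n + 1) := by
      rintro x ⟨hx1, hx2⟩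
      rcases lt_or_ge x n with h | h
      · exact Or.inl ⟨h, hx2⟩
      · exact Or.inr ⟨h, by simpa using hx1⟩
    exact ⟨(ih.1.union h1).mono_set hsub,
      (aestronglyMeasurable_union_iff.2 ⟨ih.2, h2⟩).mono_measure
        (Measure.restrict_mono hsub le_rfl)⟩

theorem LocallySquareIntegrable.history (hf : LocallySquareIntegrable f) :
    LocallySquareIntegrable (history c k f) := by
  intro a b
  obtain ⟨n, hn⟩ := exists_nat_gt b
  obtain ⟨h1, h2⟩ := intervalIntegrable_sq_history (c := c) (k := k) hf n a
  have hs : Ioc a b ⊆ Iio (n : ℝ) ∩ Ioi a := fun x hx => ⟨hx.2.trans_lt hn, hx.1⟩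
  exact (memLp_two_iff_integrable_sq (h2.mono_measure (Measure.restrict_mono hs le_rfl))).2
    (h1.mono_set hs)

theorem integral_history_comp (g : ℝ → ℝ) (n : ℕ) {p q : ℝ} (hp : 0 ≤ p) (hpq : p ≤ q)
    (hq : q ≤ 1) : ∫ t in (n + p)..(n + q), g (history c k f t)
      = ∫ s in p..q, g ((step c k)^[n] f s) := by
  have h1 : ∫ t in (n + p)..(n + q), g (history c k f t)
      = ∫ t in (n + p)..(n + q), g ((step c k)^[n] f (t - n)) := by
    refine intervalIntegral.integral_congr_Ioo_of_le (by linarith) fun t ht => ?_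
    rw [history_eq n ⟨by linarith [ht.1], by linarith [ht.2]⟩]
  rw [h1, intervalIntegral.integral_comp_sub_right (fun s => g ((step c k)^[n] f s)) (n : ℝ)]
  simp

/-- The boundary condition, as a delay equation for the influx. -/
theorem history_add_one (hf : LocallySquareIntegrable f) {s : ℝ} (hs : 0 ≤ s) :
    history c k f (s + 1) = k * history c k f s - c * ∫ t in s..(s + 1), history c k f t := by
  set n := ⌊s⌋₊ with hn
  have h1 : (n : ℝ) ≤ s := Nat.floor_le hs
  have h2 : s < n + 1 := Nat.lt_floor_add_one s
  have e1 : history c k f s = (step c k)^[n] f (s - n) := history_eq n ⟨h1, h2⟩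
  have e2 : history c k f (s + 1) = step c k ((step c k)^[n] f) (s - n) := by
    rw [history_eq (n + 1) ⟨by push_cast; linarith, by push_cast; linarith⟩,
      Function.iterate_succ_apply']
    congr 1
    push_cast
    ring
  have hH := hf.history (c := c) (k := k)
  have e3 : ∫ t in s..(s + 1), history c k f t
      = inFlightMass c k ((step c k)^[n] f) (s - n) := by
    have hg := hf.iterate_step (c := c) (k := k) n
    have i1 := integral_history_comp (c := c) (k := k) (f := f) id n (p := s - n) (q := 1)
      (by linarith) (by linarith) le_rfl
    have i2 := integral_history_comp (c := c) (k := k) (f := f) id (n + 1) (p := 0) (q := s - n)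
      le_rfl (by linarith) (by linarith)
    rw [Function.iterate_succ_apply'] at i2
    simp only [id] at i1 i2
    rw [show (n : ℝ) + (s - n) = s by ring] at i1
    rw [show ((n + 1 : ℕ) : ℝ) + 0 = n + 1 by push_cast; ring,
      show ((n + 1 : ℕ) : ℝ) + (s - n) = s + 1 by push_cast; ring] at i2
    -- The window of length one meets two transits: the end of the `n`-th and the beginning of the
    -- next. Conservation of mass identifies the sum.
    rw [← intervalIntegral.integral_add_adjacent_intervals (b := (n : ℝ) + 1)
      (hH.intervalIntegrable _ _) (hH.intervalIntegrable _ _), i1, i2,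
      inFlightMass_eq_sub_add hg]
    have := intervalIntegral.integral_interval_sub_left (hg.intervalIntegrable 0 1)
      (hg.intervalIntegrable 0 (s - n))
    simp only [primitive]
    linarith
  rw [e2, e1, e3, step]

/-! ### The profiles -/

/-- The profile at time `t`, when the history of the influx is `V` and the velocity is `a`. -/
def profile {V : ℝ → ℝ} (hV : LocallySquareIntegrable V) (a t : ℝ) : L2 :=
  ((hV.comp_sub_left (a * t + 1)).memLp_Ioo 0 1).toLp _

variable {V : ℝ → ℝ} {a : ℝ}

theorem coeFn_profile (hV : LocallySquareIntegrable V) (a t : ℝ) :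
    profile hV a t =ᵐ[volume.restrict (Ioo 0 1)] fun x => V (a * t + 1 - x) :=
  MemLp.coeFn_toLp _

theorem integral_Ioo_eq (g : ℝ → ℝ) {p q : ℝ} (hpq : p ≤ q) :
    ∫ x in Ioo p q, g x = ∫ x in p..q, g x := by
  rw [intervalIntegral.integral_of_le hpq, integral_Ioc_eq_integral_Ioo]

theorem integral_profile_comp (hV : LocallySquareIntegrable V) (a t : ℝ) (g : ℝ → ℝ → ℝ) :
    ∫ x in Ioo (0 : ℝ) 1, g x (profile hV a t x)
      = ∫ σ in (a * t)..(a * t + 1), g (a * t + 1 - σ) (V σ) := by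
  have h1 : ∫ x in Ioo (0 : ℝ) 1, g x (profile hV a t x)
      = ∫ x in Ioo (0 : ℝ) 1, g x (V (a * t + 1 - x)) := by
    refine integral_congr_ae ?_
    filter_upwards [coeFn_profile hV a t] with x hx
    rw [hx]
  rw [h1, integral_Ioo_eq _ zero_le_one]
  have h2 := intervalIntegral.integral_comp_sub_left (a := 0) (b := 1)
    (fun σ => g (a * t + 1 - σ) (V σ)) (a * t + 1)
  simpa using h2

theorem mass_profile (hV : LocallySquareIntegrable V) (a t : ℝ) :
    mass (profile hV a t) = ∫ σ in (a * t)..(a * t + 1), V σ :=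
  integral_profile_comp hV a t fun _ v => v

theorem norm_sq_eq_integral (r : L2) : ‖r‖ ^ 2 = ∫ x in Ioo (0 : ℝ) 1, r x ^ 2 := by
  rw [← real_inner_self_eq_norm_sq, L2.inner_def]
  simp [sq]

theorem norm_sq_profile (hV : LocallySquareIntegrable V) (a t : ℝ) :
    ‖profile hV a t‖ ^ 2 = ∫ σ in (a * t)..(a * t + 1), V σ ^ 2 := by
  rw [norm_sq_eq_integral]
  exact integral_profile_comp hV a t fun _ v => v ^ 2

/-- Near `t₀` the profiles are restrictions of translated reflections of one function in `L²(ℝ)`,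
namely `V` cut off to `(0, B]`, and translation is continuous in `L²`. -/
theorem continuousOn_profile (hV : LocallySquareIntegrable V) (ha : 0 < a) :
    ContinuousOn (profile hV a) (Ici 0) := by
  intro t₀ ht₀
  set B := a * (t₀ + 1) + 1 with hB
  have hZ : MemLp ((Ioc 0 B).indicator V) 2 volume :=
    (memLp_indicator_iff_restrict measurableSet_Ioc).2 (hV 0 B)
  let γ : ℝ → C(ℝ, ℝ) := fun t => ⟨fun x => a * t + 1 - x, by fun_prop⟩
  have hγ : Continuous γ := ContinuousMap.continuous_of_continuous_uncurry _ (by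
    simp only [γ, Function.uncurry_def, ContinuousMap.coe_mk]; fun_prop)
  have hγm : ∀ t, MeasurePreserving (γ t) volume volume := fun t =>
    volume.measurePreserving_sub_left (a * t + 1)
  have hcont : Continuous fun t => LpToLpRestrictCLM ℝ ℝ ℝ volume 2 (Ioo 0 1)
      (Lp.compMeasurePreserving (γ t) (hγm t) (hZ.toLp _)) :=
    (LpToLpRestrictCLM ℝ ℝ ℝ volume 2 (Ioo 0 1)).continuous.comp
      (continuous_const.compMeasurePreservingLp hγ hγm (by simp))
  refine (hcont.continuousAt.continuousWithinAt (s := Ici 0) (x := t₀)).congr_of_eventuallyEq_of_mem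
    ?_ ht₀
  filter_upwards [self_mem_nhdsWithin,
    mem_nhdsWithin_of_mem_nhds (Iio_mem_nhds (lt_add_one t₀))] with t ht ht'
  refine Lp.ext ?_
  refine (coeFn_profile hV a t).trans ?_
  refine Filter.EventuallyEq.trans ?_ (LpToLpRestrictCLM_coeFn ℝ (Ioo 0 1) _).symm
  have h1 : Lp.compMeasurePreserving (γ t) (hγm t) (hZ.toLp _)
      =ᵐ[volume] (Ioc 0 B).indicator V ∘ γ t :=
    (Lp.coeFn_compMeasurePreserving _ (hγm t)).trans
      ((hγm t).quasiMeasurePreserving.ae_eq_comp hZ.coeFn_toLp)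
  filter_upwards [ae_restrict_of_ae h1, ae_restrict_mem measurableSet_Ioo] with x hx hx'
  rw [hx]
  have ht0 : 0 ≤ a * t := mul_nonneg ha.le ht
  have htB : a * t ≤ a * (t₀ + 1) := mul_le_mul_of_nonneg_left (le_of_lt ht') ha.le
  have hmem : a * t + 1 - x ∈ Ioc 0 B := ⟨by linarith [hx'.2], by linarith [hx'.1]⟩
  simp only [Function.comp, γ, ContinuousMap.coe_mk, indicator_of_mem hmem]

end

section

variable {c k : ℝ} {V : ℝ → ℝ} {a : ℝ}

/-! ### The weak identity for the profiles -/

theorem hasDerivAt_characteristic {φ : ℝ × ℝ → ℝ} (hφ : ContDiff ℝ 1 φ) (a σ t : ℝ) :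
    HasDerivAt (fun t => φ (t, a * t + 1 - σ)) (fderiv ℝ φ (t, a * t + 1 - σ) (1, a)) t := by
  have h1 : HasDerivAt (fun t : ℝ => (t, a * t + 1 - σ)) ((1 : ℝ), a) t := by
    refine (hasDerivAt_id t).prodMk ?_
    simpa using (((hasDerivAt_id t).const_mul a).add_const 1).sub_const σ
  exact ((hφ.differentiable one_ne_zero _).hasFDerivAt).comp_hasDerivAt t h1

theorem deriv_add_mul_deriv {φ : ℝ × ℝ → ℝ} (hφ : ContDiff ℝ 1 φ) (a t x : ℝ) :
    deriv (fun s => φ (s, x)) t + a * deriv (fun z => φ (t, z)) x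
      = fderiv ℝ φ (t, x) (1, a) := by
  have hd := (hφ.differentiable one_ne_zero (t, x)).hasFDerivAt
  have h1 : HasDerivAt (fun s => φ (s, x)) (fderiv ℝ φ (t, x) (1, 0)) t :=
    hd.comp_hasDerivAt t ((hasDerivAt_id t).prodMk (hasDerivAt_const t x))
  have h2 : HasDerivAt (fun z => φ (t, z)) (fderiv ℝ φ (t, x) (0, 1)) x :=
    hd.comp_hasDerivAt x ((hasDerivAt_const x t).prodMk (hasDerivAt_id x))
  rw [h1.deriv, h2.deriv]
  have : ((1 : ℝ), a) = (1, 0) + a • ((0 : ℝ), (1 : ℝ)) := by simp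
  rw [this, map_add, map_smul, smul_eq_mul]

/-- Fubini's theorem along the characteristics. -/
theorem integral_characteristics (hV : LocallySquareIntegrable V) (ha : 0 < a)
    {φ : ℝ × ℝ → ℝ} (hφ : ContDiff ℝ 1 φ) {τ : ℝ} (hτ : 0 ≤ τ) :
    ∫ t in (0 : ℝ)..τ, ∫ σ in (a * t)..(a * t + 1),
        V σ * fderiv ℝ φ (t, a * t + 1 - σ) (1, a)
      = ∫ σ in (0 : ℝ)..(a * τ + 1), V σ *
          (φ (min τ (σ / a), a * min τ (σ / a) + 1 - σ)
            - φ (max 0 ((σ - 1) / a), a * max 0 ((σ - 1) / a) + 1 - σ)) := by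
  set H : ℝ × ℝ → ℝ := fun p => fderiv ℝ φ (p.1, a * p.1 + 1 - p.2) (1, a) with hH
  have hHc : Continuous H :=
    ((hφ.continuous_fderiv one_ne_zero).comp (by fun_prop)).clm_apply continuous_const
  have haτ : 0 ≤ a * τ := mul_nonneg ha.le hτ
  set S : Set (ℝ × ℝ) := {p | a * p.1 < p.2 ∧ p.2 ≤ a * p.1 + 1} with hS
  have hSm : MeasurableSet S :=
    (measurableSet_lt (f := fun p : ℝ × ℝ => a * p.1) (g := fun p => p.2) (by fun_prop)
      (by fun_prop)).inter (measurableSet_le (f := fun p : ℝ × ℝ => p.2)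
        (g := fun p => a * p.1 + 1) (by fun_prop) (by fun_prop))
  set F : ℝ → ℝ → ℝ := fun t σ => S.indicator (fun p => V p.2 * H p) (t, σ) with hF
  have hint : Integrable (Function.uncurry F)
      ((volume.restrict (Ioc 0 τ)).prod (volume.restrict (Ioc 0 (a * τ + 1)))) := by
    have h1 : Integrable (fun p : ℝ × ℝ => V p.2)
        ((volume.restrict (Ioc 0 τ)).prod (volume.restrict (Ioc 0 (a * τ + 1)))) :=
      ((hV 0 (a * τ + 1)).integrable one_le_two).comp_snd _
    obtain ⟨C, hC⟩ := (isCompact_Icc.prod isCompact_Icc).exists_bound_of_continuousOn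
      (s := Icc 0 τ ×ˢ Icc 0 (a * τ + 1)) hHc.continuousOn
    have h2 : Integrable (fun p : ℝ × ℝ => V p.2 * H p)
        ((volume.restrict (Ioc 0 τ)).prod (volume.restrict (Ioc 0 (a * τ + 1)))) := by
      refine h1.mul_bdd (c := C) hHc.aestronglyMeasurable ?_
      rw [Measure.prod_restrict]
      filter_upwards [ae_restrict_mem (measurableSet_Ioc.prod measurableSet_Ioc)] with p hp
      exact hC p ⟨⟨hp.1.1.le, hp.1.2⟩, ⟨hp.2.1.le, hp.2.2⟩⟩
    exact h2.indicator hSm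
  have hswap := integral_integral_swap hint
  have hleft : ∫ t in (0 : ℝ)..τ, ∫ σ in (a * t)..(a * t + 1), V σ * H (t, σ)
      = ∫ t in Ioc 0 τ, ∫ σ in Ioc 0 (a * τ + 1), F t σ := by
    rw [intervalIntegral.integral_of_le hτ]
    refine setIntegral_congr_fun measurableSet_Ioc fun t ht => ?_
    have hFt : ∀ σ, F t σ = (Ioc (a * t) (a * t + 1)).indicator (fun σ => V σ * H (t, σ)) σ :=
      fun σ => rfl
    have hsub : Ioc (a * t) (a * t + 1) ⊆ Ioc 0 (a * τ + 1) :=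
      Ioc_subset_Ioc (mul_nonneg ha.le ht.1.le)
        (by linarith [mul_le_mul_of_nonneg_left ht.2 ha.le])
    simp only [hFt]
    rw [intervalIntegral.integral_of_le (by linarith), setIntegral_indicator measurableSet_Ioc,
      inter_eq_right.2 hsub]
  have hright : ∫ σ in Ioc 0 (a * τ + 1), ∫ t in Ioc 0 τ, F t σ
      = ∫ σ in (0 : ℝ)..(a * τ + 1), V σ *
          (φ (min τ (σ / a), a * min τ (σ / a) + 1 - σ)
            - φ (max 0 ((σ - 1) / a), a * max 0 ((σ - 1) / a) + 1 - σ)) := by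
    rw [intervalIntegral.integral_of_le (by linarith)]
    refine setIntegral_congr_fun measurableSet_Ioc fun σ hσ => ?_
    have hFσ : ∀ t, F t σ
        = (Ico ((σ - 1) / a) (σ / a)).indicator (fun t => V σ * H (t, σ)) t := by
      intro t
      have : (t, σ) ∈ S ↔ t ∈ Ico ((σ - 1) / a) (σ / a) := by
        simp only [hS, mem_ofPred_eq, mem_Ico, div_le_iff₀ ha, lt_div_iff₀ ha]
        constructor <;> rintro ⟨h1, h2⟩ <;> constructor <;> linarith
      by_cases h : (t, σ) ∈ S
      · simp only [hF]
        rw [indicator_of_mem h, indicator_of_mem (this.1 h)]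
      · simp only [hF]
        rw [indicator_of_notMem h, indicator_of_notMem (mt this.2 h)]
    have hle : max 0 ((σ - 1) / a) ≤ min τ (σ / a) := by
      refine max_le (le_min hτ (div_nonneg hσ.1.le ha.le)) (le_min ?_ ?_)
      · rw [div_le_iff₀ ha]; linarith [hσ.2]
      · gcongr; linarith
    simp only [hFσ]
    rw [setIntegral_indicator measurableSet_Ico,
      setIntegral_congr_set ((ae_eq_refl _).inter Ico_ae_eq_Ioc), Ioc_inter_Ioc,
      ← intervalIntegral.integral_of_le hle, intervalIntegral.integral_const_mul]
    congr 1
    exact intervalIntegral.integral_eq_sub_of_hasDerivAt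
      (fun t _ => hasDerivAt_characteristic hφ a σ t)
      (Continuous.intervalIntegrable (hHc.comp (by fun_prop : Continuous fun t : ℝ => (t, σ))) _ _)
  rw [← hright, ← hswap, ← hleft]

/-- The weak form of the transport equation. -/
theorem integral_transport (hV : LocallySquareIntegrable V) (ha : 0 < a)
    {φ : ℝ × ℝ → ℝ} (hφ : ContDiff ℝ 1 φ) {τ : ℝ} (hτ : 0 ≤ τ)
    (hend : ∀ x ∈ Icc (0 : ℝ) 1, φ (τ, x) = 0) :
    ∫ t in (0 : ℝ)..τ, ∫ σ in (a * t)..(a * t + 1),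
        V σ * fderiv ℝ φ (t, a * t + 1 - σ) (1, a)
      = (∫ t in (0 : ℝ)..τ, a * V (a * t) * φ (t, 1))
        - (∫ x in (0 : ℝ)..1, V (1 - x) * φ (0, x))
        - ∫ t in (0 : ℝ)..τ, a * V (a * t + 1) * φ (t, 0) := by
  have hφc := hφ.continuous
  have haτ : 0 ≤ a * τ := mul_nonneg ha.le hτ
  have ha' : a ≠ 0 := ha.ne'
  -- `P` and `Q` are the values of `φ` where the particle's path ends and begins. Paths end at `x =
  -- 1` or at time `τ`, where `φ` vanishes; they begin at time `0` if `σ ≤ 1` and at `x = 0`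
  -- otherwise.
  set P : ℝ → ℝ := fun σ => φ (min τ (σ / a), a * min τ (σ / a) + 1 - σ) with hP
  set Q : ℝ → ℝ := fun σ => φ (max 0 ((σ - 1) / a), a * max 0 ((σ - 1) / a) + 1 - σ) with hQ
  have hPc : Continuous P := by fun_prop
  have hQc : Continuous Q := by fun_prop
  have iP : ∀ p q, IntervalIntegrable (fun σ => V σ * P σ) volume p q := fun p q =>
    (hV.intervalIntegrable p q).mul_continuousOn hPc.continuousOn
  have iQ : ∀ p q, IntervalIntegrable (fun σ => V σ * Q σ) volume p q := fun p q =>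
    (hV.intervalIntegrable p q).mul_continuousOn hQc.continuousOn
  rw [integral_characteristics hV ha hφ hτ]
  have hsplit : ∫ σ in (0 : ℝ)..(a * τ + 1), V σ * (P σ - Q σ)
      = (∫ σ in (0 : ℝ)..(a * τ + 1), V σ * P σ) - ∫ σ in (0 : ℝ)..(a * τ + 1), V σ * Q σ := by
    rw [← intervalIntegral.integral_sub (iP _ _) (iQ _ _)]
    simp only [mul_sub]
  have hPint : ∫ σ in (0 : ℝ)..(a * τ + 1), V σ * P σ
      = ∫ t in (0 : ℝ)..τ, a * V (a * t) * φ (t, 1) := by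
    rw [← intervalIntegral.integral_add_adjacent_intervals (iP 0 (a * τ)) (iP _ _)]
    have h0 : ∫ σ in (a * τ)..(a * τ + 1), V σ * P σ = 0 := by
      refine (intervalIntegral.integral_congr (g := fun _ => (0 : ℝ)) fun σ hσ => ?_).trans
        intervalIntegral.integral_zero
      rw [uIcc_of_le (by linarith)] at hσ
      have : min τ (σ / a) = τ := min_eq_left (by rw [le_div_iff₀ ha]; linarith [hσ.1])
      simp only [hP, this]
      rw [hend _ ⟨by linarith [hσ.2], by linarith [hσ.1]⟩, mul_zero]
    have h1 := intervalIntegral.smul_integral_comp_mul_left (a := 0) (b := τ)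
      (fun σ => V σ * P σ) a
    rw [mul_zero] at h1
    rw [h0, add_zero, ← h1, smul_eq_mul, ← intervalIntegral.integral_const_mul]
    refine intervalIntegral.integral_congr fun t ht => ?_
    rw [uIcc_of_le hτ] at ht
    have h2 : a * t / a = t := by field_simp
    simp only [hP, h2, min_eq_right ht.2, add_sub_cancel_left]
    ring
  have hQint : ∫ σ in (0 : ℝ)..(a * τ + 1), V σ * Q σ
      = (∫ x in (0 : ℝ)..1, V (1 - x) * φ (0, x))
        + ∫ t in (0 : ℝ)..τ, a * V (a * t + 1) * φ (t, 0) := by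
    rw [← intervalIntegral.integral_add_adjacent_intervals (iQ 0 1) (iQ _ _)]
    congr 1
    · have h1 := intervalIntegral.integral_comp_sub_left (a := 0) (b := 1)
        (fun σ => V σ * Q σ) 1
      simp only [sub_self, sub_zero] at h1
      rw [← h1]
      refine intervalIntegral.integral_congr fun x hx => ?_
      rw [uIcc_of_le zero_le_one] at hx
      have h2 : max 0 ((1 - x - 1) / a) = 0 :=
        max_eq_left (div_nonpos_of_nonpos_of_nonneg (by linarith [hx.1]) ha.le)
      simp only [hQ, h2]
      congr 3
      ring
    · have h1 := intervalIntegral.smul_integral_comp_mul_add (a := 0) (b := τ)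
        (fun σ => V σ * Q σ) a 1
      simp only [mul_zero, zero_add] at h1
      rw [← h1, smul_eq_mul, ← intervalIntegral.integral_const_mul]
      refine intervalIntegral.integral_congr fun t ht => ?_
      rw [uIcc_of_le hτ] at ht
      have h2 : (a * t + 1 - 1) / a = t := by field_simp; ring
      simp only [hQ, h2, max_eq_right ht.1, sub_self]
      ring
  rw [hsplit, hPint, hQint]
  ring

/-- The profiles of a history obeying the delay equation form a weak solution. -/
theorem isWeakSolution_profile {vel : ℝ → ℝ} {rhobar : ℝ} (hpos : 0 < vel rhobar)
    (hV : LocallySquareIntegrable V)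
    (hdelay : ∀ s, 0 ≤ s → V (s + 1)
      = k * V s - (1 - k) * dParam vel rhobar * ∫ t in s..(s + 1), V t)
    {ρ₀ : L2} (hinit : ρ₀ =ᵐ[volume.restrict (Ioo 0 1)] fun x => V (1 - x)) :
    IsWeakSolution vel rhobar k ρ₀ (profile hV (vel rhobar)) := by
  set a := vel rhobar with ha
  have hyl : LocallySquareIntegrable fun t => a * V (a * t) := by
    simpa using (hV.comp_affine hpos.ne' 0).const_mul a
  have hul : LocallySquareIntegrable fun t => a * V (a * t + 1) :=
    (hV.comp_affine hpos.ne' 1).const_mul a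
  refine ⟨continuousOn_profile hV hpos, fun t => a * V (a * t), fun T _ => hyl.memLp_Ioo 0 T,
    fun τ hτ φ hφ hend => ?_⟩
  have hφc := hφ.continuous
  unfold WeakIdentity
  rw [← ha]
  have h1 : ∫ t in (0 : ℝ)..τ, ∫ x in Ioo (0 : ℝ) 1, (profile hV a t) x *
        (deriv (fun s => φ (s, x)) t + a * deriv (fun z => φ (t, z)) x)
      = ∫ t in (0 : ℝ)..τ, ∫ σ in (a * t)..(a * t + 1),
          V σ * fderiv ℝ φ (t, a * t + 1 - σ) (1, a) := by
    congr 1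
    funext t
    simp only [deriv_add_mul_deriv hφ]
    exact integral_profile_comp hV a t fun x v => v * fderiv ℝ φ (t, x) (1, a)
  have h2 : ∫ x in Ioo (0 : ℝ) 1, ρ₀ x * φ (0, x) = ∫ x in (0 : ℝ)..1, V (1 - x) * φ (0, x) := by
    rw [← integral_Ioo_eq _ zero_le_one]
    refine integral_congr_ae ?_
    filter_upwards [hinit] with x hx
    rw [hx]
  have h3 : ∫ t in (0 : ℝ)..τ, (a * V (a * t) * φ (t, 1)
        - (k * (a * V (a * t)) + (k - 1) * dParam vel rhobar * a * mass (profile hV a t)) * φ (t, 0))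
      = (∫ t in (0 : ℝ)..τ, a * V (a * t) * φ (t, 1))
        - ∫ t in (0 : ℝ)..τ, a * V (a * t + 1) * φ (t, 0) := by
    rw [← intervalIntegral.integral_sub]
    · refine intervalIntegral.integral_congr fun t ht => ?_
      rw [uIcc_of_le hτ] at ht
      simp only [mass_profile, hdelay (a * t) (mul_nonneg hpos.le ht.1)]
      ring
    · exact (hyl.intervalIntegrable 0 τ).mul_continuousOn
        (by fun_prop : Continuous fun t => φ (t, 1)).continuousOn
    · exact (hul.intervalIntegrable 0 τ).mul_continuousOn
        (by fun_prop : Continuous fun t => φ (t, 0)).continuousOn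
  rw [h1, h2, h3, integral_transport hV hpos hφ hτ hend]
  ring

/-- The influx that is attached to an initial datum. -/
def initialInflux (r : L2) : ℝ → ℝ := (Ioc (0 : ℝ) 1).indicator fun s => r (1 - s)

theorem locallySquareIntegrable_initialInflux (r : L2) :
    LocallySquareIntegrable (initialInflux r) := by
  have h1 : MemLp (fun s => r (1 - s)) 2 (volume.restrict (Ioo (0 : ℝ) 1)) := by
    refine (Lp.memLp r).comp_measurePreserving ?_
    have := (volume.measurePreserving_sub_left (1 : ℝ)).restrict_preimage
      (measurableSet_Ioo (a := (0 : ℝ)) (b := 1))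
    simpa using this
  have h2 : MemLp (initialInflux r) 2 volume := by
    refine (memLp_indicator_iff_restrict measurableSet_Ioc).2 ?_
    rw [← restrict_Ioo_eq_restrict_Ioc]
    exact h1
  exact fun p q => h2.restrict _

theorem initialInflux_one_sub (r : L2) {x : ℝ} (hx : x ∈ Ioo (0 : ℝ) 1) :
    initialInflux r (1 - x) = r x := by
  have : 1 - x ∈ Ioc (0 : ℝ) 1 := ⟨by linarith [hx.2], by linarith [hx.1]⟩
  rw [initialInflux, indicator_of_mem this, sub_sub_cancel]

theorem normSq_initialInflux (r : L2) : normSq (initialInflux r) = ‖r‖ ^ 2 := by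
  have h := intervalIntegral.integral_comp_sub_left (a := 0) (b := 1)
    (fun s => initialInflux r s ^ 2) 1
  simp only [sub_self, sub_zero] at h
  rw [normSq, ← h, norm_sq_eq_integral, ← integral_Ioo_eq _ zero_le_one]
  refine setIntegral_congr_fun measurableSet_Ioo fun x hx => ?_
  simp only [initialInflux_one_sub r hx]

/-- The weak solution with a given initial datum. -/
def solution (vel : ℝ → ℝ) (rhobar k : ℝ) (ρ₀ : L2) : ℝ → L2 :=
  profile ((locallySquareIntegrable_initialInflux ρ₀).history
    (c := (1 - k) * dParam vel rhobar) (k := k)) (vel rhobar)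

theorem isWeakSolution_solution {vel : ℝ → ℝ} {rhobar : ℝ} (hpos : 0 < vel rhobar) (k : ℝ)
    (ρ₀ : L2) : IsWeakSolution vel rhobar k ρ₀ (solution vel rhobar k ρ₀) := by
  have hf := locallySquareIntegrable_initialInflux ρ₀
  refine isWeakSolution_profile hpos _ (fun s hs => history_add_one hf hs) ?_
  filter_upwards [ae_restrict_mem measurableSet_Ioo] with x hx
  rw [history_of_lt_one (by linarith [hx.1]), initialInflux_one_sub ρ₀ hx]

end

section

variable {k a κ : ℝ}

/-! ### Uniqueness -/

/-- Integration against a profile. -/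
def pairing (r : L2) (g : ℝ → ℝ) : ℝ := ∫ x in Ioo (0 : ℝ) 1, r x * g x

theorem mass_eq_pairing (r : L2) : mass r = pairing r fun _ => 1 := by
  simp [mass, pairing]

theorem Continuous.memLp_unit {g : ℝ → ℝ} (hg : Continuous g) :
    MemLp g 2 (volume.restrict (Ioo (0 : ℝ) 1)) :=
  (LocallySquareIntegrable.of_continuous hg).memLp_Ioo 0 1

theorem pairing_eq_inner (r : L2) {g : ℝ → ℝ} (hg : Continuous g) :
    pairing r g = inner ℝ ((Continuous.memLp_unit hg).toLp g) r := by
  rw [L2.inner_def, pairing]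
  refine integral_congr_ae ?_
  filter_upwards [(Continuous.memLp_unit hg).coeFn_toLp] with x hx
  simp [hx]

theorem pairing_sub (r r' : L2) {g : ℝ → ℝ} (hg : Continuous g) :
    pairing (r - r') g = pairing r g - pairing r' g := by
  simp only [pairing_eq_inner _ hg, inner_sub_right]

theorem continuousOn_pairing {ρ : ℝ → L2} {s : Set ℝ} (hρ : ContinuousOn ρ s)
    {g : ℝ → ℝ → ℝ} (hg : Continuous fun p : ℝ × ℝ => g p.1 p.2) :
    ContinuousOn (fun t => pairing (ρ t) (g t)) s := by
  have hgt : ∀ t, Continuous (g t) := fun t => hg.comp (by fun_prop : Continuous fun x : ℝ => (t, x))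
  set G : ℝ → L2 := fun t => (Continuous.memLp_unit (hgt t)).toLp (g t) with hG
  -- Joint continuity gives uniform convergence on `[0,1]`, and the sup norm dominates the `L²` norm
  -- there.
  have hGc : Continuous G := by
    let γ : ℝ → C(ℝ, ℝ) := fun t => ⟨g t, hgt t⟩
    have hγ : Continuous fun t => (γ t).restrict (Icc 0 1) :=
      (ContinuousMap.continuous_restrict _).comp
        (ContinuousMap.continuous_of_continuous_uncurry _ hg)
    refine Metric.continuous_iff'.2 fun t₀ ε hε => ?_
    filter_upwards [Metric.continuous_iff'.1 hγ t₀ (ε / 2) (by linarith)] with t ht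
    have hb : ‖G t - G t₀‖ ≤ ε / 2 := by
      have := Lp.norm_le_of_ae_bound (f := G t - G t₀) (C := ε / 2) (by linarith) (by
        filter_upwards [Lp.coeFn_sub (G t) (G t₀), (Continuous.memLp_unit (hgt t)).coeFn_toLp,
          (Continuous.memLp_unit (hgt t₀)).coeFn_toLp, ae_restrict_mem measurableSet_Ioo]
          with x h1 h2 h3 hx
        rw [h1, Pi.sub_apply, hG]
        simp only
        rw [h2, h3, ← dist_eq_norm]
        have := ContinuousMap.dist_apply_le_dist (f := (γ t).restrict (Icc 0 1))
          (g := (γ t₀).restrict (Icc 0 1)) ⟨x, hx.1.le, hx.2.le⟩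
        exact this.trans ht.le)
      simpa [measureUnivNNReal] using this
    rw [dist_eq_norm]
    linarith
  have : (fun t => pairing (ρ t) (g t)) = fun t => inner ℝ (G t) (ρ t) :=
    funext fun t => pairing_eq_inner _ (hgt t)
  rw [this]
  exact hGc.continuousOn.inner hρ

theorem continuousOn_mass {ρ : ℝ → L2} {s : Set ℝ} (hρ : ContinuousOn ρ s) :
    ContinuousOn (fun t => mass (ρ t)) s := by
  simp only [mass_eq_pairing]
  exact continuousOn_pairing hρ (g := fun _ _ => 1) continuous_const

/-- Integration by parts for two primitives, one vanishing at each end point. -/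
theorem integral_mul_primitive_add {p q : ℝ → ℝ} {τ : ℝ}
    (hp : IntervalIntegrable p volume 0 τ) (hq : IntervalIntegrable q volume 0 τ) :
    (∫ t in (0 : ℝ)..τ, p t * ∫ s in (0 : ℝ)..t, q s)
      + (∫ t in (0 : ℝ)..τ, (∫ s in τ..t, p s) * q t) = 0 := by
  have hA : AbsolutelyContinuousOnInterval (fun t => ∫ s in τ..t, p s) 0 τ :=
    hp.absolutelyContinuousOnInterval_intervalIntegral (by simp)
  have hB : AbsolutelyContinuousOnInterval (fun t => ∫ s in (0 : ℝ)..t, q s) 0 τ :=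
    hq.absolutelyContinuousOnInterval_intervalIntegral (by simp)
  have h := hA.integral_deriv_mul_eq_sub hB
  rw [← intervalIntegral.integral_add (hp.mul_continuousOn hB.continuousOn)
    (hq.continuousOn_mul hA.continuousOn)]
  simp only [intervalIntegral.integral_same, zero_mul, mul_zero, sub_zero] at h
  refine (intervalIntegral.integral_congr_ae ?_).trans h
  filter_upwards [hp.ae_hasDerivAt_integral, hq.ae_hasDerivAt_integral] with x h1 h2 hx
  rw [(h1 (uIoc_subset_uIcc hx) τ (by simp)).deriv, (h2 (uIoc_subset_uIcc hx) 0 (by simp)).deriv]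

theorem intervalIntegrable_of_memLp {y : ℝ → ℝ} {T : ℝ} (hT : 0 ≤ T)
    (hy : MemLp y 2 (volume.restrict (Ioo 0 T))) : IntervalIntegrable y volume 0 T :=
  (intervalIntegrable_iff_integrableOn_Ioo_of_le hT).2 (hy.integrable one_le_two)

/-- A weak solution tested against a function carried by the flow. -/
theorem pairing_weakSolution {vel : ℝ → ℝ} {rhobar : ℝ} {ρ₀ : L2} {ρ : ℝ → L2} {y : ℝ → ℝ}
    (hρ : ContinuousOn ρ (Ici 0)) (hy : ∀ T : ℝ, 0 < T → MemLp y 2 (volume.restrict (Ioo 0 T)))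
    (hweak : ∀ τ : ℝ, 0 ≤ τ → ∀ φ : ℝ × ℝ → ℝ, ContDiff ℝ 1 φ →
      (∀ x ∈ Icc (0 : ℝ) 1, φ (τ, x) = 0) → WeakIdentity vel rhobar k ρ₀ ρ y τ φ)
    {η : ℝ → ℝ} (hη : ContDiff ℝ 1 η) {t : ℝ} (ht : 0 ≤ t) :
    pairing (ρ t) (fun x => η (x - vel rhobar * t)) = pairing ρ₀ η
      + ∫ s in (0 : ℝ)..t, ((k * y s + (k - 1) * dParam vel rhobar * vel rhobar * mass (ρ s))
          * η (-(vel rhobar * s)) - y s * η (1 - vel rhobar * s)) := by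
  set a := vel rhobar with ha
  -- A horizon beyond `t` makes the interval nondegenerate even for `t = 0`.
  set τ := t + 1 with hτ
  have hτ0 : 0 < τ := by linarith
  have hηc := hη.continuous
  set u : ℝ → ℝ := fun s => k * y s + (k - 1) * dParam vel rhobar * a * mass (ρ s) with hu
  set q : ℝ → ℝ := fun s => u s * η (-(a * s)) - y s * η (1 - a * s) with hq
  set m : ℝ → ℝ := fun t => pairing (ρ t) (fun x => η (x - a * t)) with hm
  have hsub : uIcc 0 τ ⊆ Ici 0 := by rw [uIcc_of_le hτ0.le]; exact Icc_subset_Ici_self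
  have hyi : IntervalIntegrable y volume 0 τ := intervalIntegrable_of_memLp hτ0.le (hy τ hτ0)
  have hui : IntervalIntegrable u volume 0 τ :=
    (hyi.const_mul k).add
      (((continuousOn_mass hρ).mono hsub).intervalIntegrable.const_mul _)
  have hqi : IntervalIntegrable q volume 0 τ :=
    (hui.mul_continuousOn (by fun_prop)).sub (hyi.mul_continuousOn (by fun_prop))
  have hmc : ContinuousOn m (Icc 0 τ) :=
    (continuousOn_pairing hρ (g := fun t x => η (x - a * t)) (by fun_prop)).mono
      Icc_subset_Ici_self
  have hQc : ContinuousOn (fun t => ∫ s in (0 : ℝ)..t, q s) (Icc 0 τ) := by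
    have := (hqi.absolutelyContinuousOnInterval_intervalIntegral (c := 0) (by simp)).continuousOn
    rwa [uIcc_of_le hτ0.le] at this
  set D : ℝ → ℝ := fun t => m t - pairing ρ₀ η - ∫ s in (0 : ℝ)..t, q s with hD
  have hDc : ContinuousOn D (Icc 0 τ) := (hmc.sub continuousOn_const).sub hQc
  -- The defect `D` of the claimed formula serves as its own test function: `θ' = D` on `[0, τ]` and
  -- `θ(τ) = 0`. The weak identity, integrated by parts in time, becomes `∫ D² = 0`.
  set ψ : ℝ → ℝ := IccExtend hτ0.le ((Icc 0 τ).domRestrict D) with hψ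
  have hψc : Continuous ψ := (continuousOn_iff_continuous_domRestrict.1 hDc).Icc_extend'
  have hψD : ∀ s ∈ Icc (0 : ℝ) τ, ψ s = D s := fun s hs => IccExtend_of_mem hτ0.le _ hs
  have hψi : IntervalIntegrable ψ volume 0 τ := hψc.intervalIntegrable _ _
  set θ : ℝ → ℝ := fun t => ∫ s in τ..t, ψ s with hθ
  have hθd : ∀ t, HasDerivAt θ (ψ t) t := fun t => (hψc.integral_hasStrictDerivAt τ t).hasDerivAt
  have hθ1 : ContDiff ℝ 1 θ :=
    contDiff_one_iff_deriv.2 ⟨fun t => (hθd t).differentiableAt, by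
      rwa [show deriv θ = ψ from funext fun t => (hθd t).deriv]⟩
  have hθc := hθ1.continuous
  set φ : ℝ × ℝ → ℝ := fun p => θ p.1 * η (p.2 - a * p.1) with hφ
  have hφ1 : ContDiff ℝ 1 φ := by fun_prop
  have hφd : ∀ t x, deriv (fun s => φ (s, x)) t + a * deriv (fun z => φ (t, z)) x
      = ψ t * η (x - a * t) := by
    intro t x
    have hηd := (hη.differentiable one_ne_zero (x - a * t)).hasDerivAt
    have e1 : HasDerivAt (fun s => φ (s, x))
        (ψ t * η (x - a * t) + θ t * (deriv η (x - a * t) * (-a))) t := by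
      refine (hθd t).mul (hηd.comp t ?_)
      simpa using ((hasDerivAt_id t).const_mul a).const_sub x
    have e2 : HasDerivAt (fun z => φ (t, z)) (θ t * (deriv η (x - a * t) * 1)) x :=
      (hηd.comp x ((hasDerivAt_id x).sub_const (a * t))).const_mul (θ t)
    rw [e1.deriv, e2.deriv]
    ring
  have hw := hweak τ hτ0.le φ hφ1 fun x _ => by simp [hφ, hθ]
  unfold WeakIdentity at hw
  rw [← ha] at hw
  have w1 : ∫ t in (0 : ℝ)..τ, ∫ x in Ioo (0 : ℝ) 1, (ρ t) x *
        (deriv (fun s => φ (s, x)) t + a * deriv (fun z => φ (t, z)) x)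
      = ∫ t in (0 : ℝ)..τ, ψ t * m t := by
    congr 1
    funext t
    simp only [hφd, hm, pairing]
    rw [← integral_const_mul]
    congr 1
    funext x
    ring
  have w2 : ∫ x in Ioo (0 : ℝ) 1, ρ₀ x * φ (0, x) = θ 0 * pairing ρ₀ η := by
    simp only [hφ, pairing, mul_zero, sub_zero]
    rw [← integral_const_mul]
    congr 1
    funext x
    ring
  have w3 : ∫ t in (0 : ℝ)..τ, (y t * φ (t, 1)
        - (k * y t + (k - 1) * dParam vel rhobar * a * mass (ρ t)) * φ (t, 0))
      = - ∫ t in (0 : ℝ)..τ, θ t * q t := by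
    rw [← intervalIntegral.integral_neg]
    congr 1
    funext t
    simp only [hφ, hq, hu, zero_sub]
    ring
  rw [w1, w2, w3] at hw
  have hparts := integral_mul_primitive_add hψi hqi
  have hθ0 : ∫ t in (0 : ℝ)..τ, ψ t = -θ 0 := by
    simp only [hθ]; rw [intervalIntegral.integral_symm]
  have hmi : IntervalIntegrable (fun t => ψ t * m t) volume 0 τ :=
    ContinuousOn.intervalIntegrable (by
      rw [uIcc_of_le hτ0.le]; exact hψc.continuousOn.mul hmc)
  have hQi : IntervalIntegrable (fun t => ψ t * ∫ s in (0 : ℝ)..t, q s) volume 0 τ :=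
    ContinuousOn.intervalIntegrable (by
      rw [uIcc_of_le hτ0.le]; exact hψc.continuousOn.mul hQc)
  have hzero : ∫ t in (0 : ℝ)..τ, D t ^ 2 = 0 := by
    have e1 : ∫ t in (0 : ℝ)..τ, D t ^ 2
        = ∫ t in (0 : ℝ)..τ, (ψ t * m t - pairing ρ₀ η * ψ t - ψ t * ∫ s in (0 : ℝ)..t, q s) := by
      refine intervalIntegral.integral_congr fun t ht => ?_
      rw [uIcc_of_le hτ0.le] at ht
      simp only [hψD t ht]
      simp only [hD]
      ring
    rw [e1, intervalIntegral.integral_sub (hmi.sub (hψi.const_mul _)) hQi,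
      intervalIntegral.integral_sub hmi (hψi.const_mul _), intervalIntegral.integral_const_mul,
      hθ0]
    linarith
  have hDt : D t = 0 := by
    by_contra hne
    have := intervalIntegral.integral_pos hτ0 (hDc.pow 2) (fun x _ => sq_nonneg _)
      ⟨t, ⟨ht, by linarith⟩, show 0 < D t ^ 2 from sq_pos_of_ne_zero hne⟩
    simp only [Pi.pow_apply] at this
    linarith
  simp only [hD, hm] at hDt
  linarith

/-- The weak formulation with zero initial datum, tested against functions carried by the flow. -/
structure IsNullSolution (a k κ : ℝ) (w : ℝ → L2) (y : ℝ → ℝ) : Prop where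
  continuousOn : ContinuousOn w (Ici 0)
  intervalIntegrable : ∀ T, 0 ≤ T → IntervalIntegrable y volume 0 T
  pairing_eq : ∀ η : ℝ → ℝ, ContDiff ℝ 1 η → ∀ t, 0 ≤ t →
    pairing (w t) (fun x => η (x - a * t))
      = ∫ s in (0 : ℝ)..t, ((k * y s + κ * mass (w s)) * η (-(a * s)) - y s * η (1 - a * s))

theorem eq_zero_of_pairing_eq_zero {r : L2}
    (h : ∀ g : ℝ → ℝ, ContDiff ℝ 1 g → pairing r g = 0) : r = 0 := by
  refine Lp.ext ?_
  have hloc : LocallyIntegrableOn r (Ioo (0 : ℝ) 1) volume :=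
    IntegrableOn.locallyIntegrableOn ((Lp.memLp r).integrable one_le_two)
  have h1 := isOpen_Ioo.ae_eq_zero_of_integral_contDiff_smul_eq_zero hloc
    fun g hg _ hsupp => by
      rw [← setIntegral_eq_integral_of_forall_compl_eq_zero (s := Ioo (0 : ℝ) 1)]
      · have := h g (hg.of_le (by exact_mod_cast le_top))
        rw [pairing] at this
        simpa [mul_comm] using this
      · intro x hx
        rw [image_eq_zero_of_notMem_tsupport fun hx' => hx (hsupp hx'), zero_smul]
  have h2 := (ae_restrict_iff' measurableSet_Ioo).2 h1
  filter_upwards [h2, Lp.coeFn_zero ℝ 2 (volume.restrict (Ioo (0 : ℝ) 1))] with x hx hx'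
  rw [hx, hx']
  rfl

namespace IsNullSolution

variable {w : ℝ → L2} {y : ℝ → ℝ}

/-- The outflux vanishes before the first transit is completed. -/
theorem outflux_ae_eq_zero (h : IsNullSolution a k κ w y) (ha : 0 < a) :
    ∀ᵐ s, s ∈ Ioo 0 (1 / a) → y s = 0 := by
  have hT : 0 < 1 / a := by positivity
  have hyT := (intervalIntegrable_iff_integrableOn_Ioo_of_le hT.le).1
    (h.intervalIntegrable (1 / a) hT.le)
  refine isOpen_Ioo.ae_eq_zero_of_integral_contDiff_smul_eq_zero hyT.locallyIntegrableOn
    fun g hg _ hsupp => ?_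
  have hg0 : ∀ s, s ∉ Ioo 0 (1 / a) → g s = 0 := fun s hs =>
    image_eq_zero_of_notMem_tsupport fun hs' => hs (hsupp hs')
  have hg1 : ContDiff ℝ 1 g := hg.of_le (by exact_mod_cast le_top)
  rw [← setIntegral_eq_integral_of_forall_compl_eq_zero (s := Ioo 0 (1 / a))
    fun s hs => by rw [hg0 s hs, zero_smul]]
  rw [integral_Ioo_eq _ hT.le]
  -- Along the outlet this test function equals `g(s)`. At the inlet and on the whole profile at
  -- time `1/a` its argument is at least `1/a`, where `g` vanishes. Only `∫ g y` survives.
  have key := h.pairing_eq (fun ξ => g ((1 - ξ) / a)) (by fun_prop) (1 / a) hT.le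
  have h1 : pairing (w (1 / a)) (fun x => g ((1 - (x - a * (1 / a))) / a)) = 0 := by
    unfold pairing
    refine (setIntegral_congr_fun (g := fun _ => (0 : ℝ)) measurableSet_Ioo fun x hx => ?_).trans
      (integral_zero _ _)
    have : (1 - (x - a * (1 / a))) / a ∉ Ioo 0 (1 / a) := by
      intro hmem
      have h2 := hmem.2
      rw [mul_one_div_cancel ha.ne', div_lt_div_iff_of_pos_right ha] at h2
      linarith [hx.2]
    simp only [hg0 _ this, mul_zero]
  have h2 : ∫ s in (0 : ℝ)..(1 / a), ((k * y s + κ * mass (w s)) * g ((1 - -(a * s)) / a)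
        - y s * g ((1 - (1 - a * s)) / a)) = - ∫ s in (0 : ℝ)..(1 / a), g s • y s := by
    rw [← intervalIntegral.integral_neg]
    refine intervalIntegral.integral_congr fun s hs => ?_
    rw [uIcc_of_le hT.le] at hs
    have h3 : (1 - -(a * s)) / a ∉ Ioo 0 (1 / a) := by
      intro hmem
      have h2 := hmem.2
      rw [div_lt_div_iff_of_pos_right ha] at h2
      linarith [mul_nonneg ha.le hs.1]
    have h4 : (1 - (1 - a * s)) / a = s := by field_simp; ring
    simp only [hg0 _ h3, h4, smul_eq_mul]
    ring
  rw [h1, h2] at key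
  linarith

/-- Without outflux, testing with the constant `1` gives `mass = κ ∫ mass`, so the mass vanishes.
The influx is then zero, and so is every pairing. -/
theorem eq_zero_of_le (h : IsNullSolution a k κ w y) (ha : 0 < a) :
    ∀ t ∈ Icc 0 (1 / a), w t = 0 := by
  have hy := h.outflux_ae_eq_zero ha
  have hT : 0 < 1 / a := by positivity
  have hred : ∀ η : ℝ → ℝ, ContDiff ℝ 1 η → ∀ t ∈ Icc 0 (1 / a),
      pairing (w t) (fun x => η (x - a * t))
        = ∫ s in (0 : ℝ)..t, κ * mass (w s) * η (-(a * s)) := by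
    intro η hη t ht
    rw [h.pairing_eq η hη t ht.1]
    refine intervalIntegral.integral_congr_ae ?_
    have hne : ∀ᵐ s : ℝ, s ≠ 1 / a := by simp [ae_iff]
    filter_upwards [hy, hne] with s hs hs' hst
    rw [uIoc_of_le ht.1] at hst
    rw [hs ⟨hst.1, lt_of_le_of_ne (hst.2.trans ht.2) hs'⟩]
    ring
  have hmass : ∀ t ∈ Icc 0 (1 / a), mass (w t) = 0 := by
    refine eq_zero_of_eq_mul_primitive (κ := κ)
      ((continuousOn_mass h.continuousOn).mono Icc_subset_Ici_self) fun t ht => ?_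
    rw [mass_eq_pairing, hred (fun _ => 1) contDiff_const t ht,
      ← intervalIntegral.integral_const_mul]
    simp
  intro t ht
  refine eq_zero_of_pairing_eq_zero fun g hg => ?_
  -- Transport undoes this shift, so an arbitrary `g` is tested at time `t`.
  have h1 := hred (fun ξ => g (ξ + a * t)) (by fun_prop) t ht
  simp only [sub_add_cancel] at h1
  rw [h1]
  refine (intervalIntegral.integral_congr (g := fun _ => (0 : ℝ)) fun s hs => ?_).trans
    intervalIntegral.integral_zero
  rw [uIcc_of_le ht.1] at hs
  simp [hmass s ⟨hs.1, hs.2.trans ht.2⟩]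

theorem shift (h : IsNullSolution a k κ w y) (ha : 0 < a) :
    IsNullSolution a k κ (fun t => w (t + 1 / a)) (fun t => y (t + 1 / a)) := by
  have hT : 0 < 1 / a := by positivity
  have hyi : ∀ t, 0 ≤ t → IntervalIntegrable y volume (1 / a) (t + 1 / a) := fun t ht =>
    (h.intervalIntegrable _ hT.le).symm.trans (h.intervalIntegrable _ (by linarith))
  refine ⟨?_, fun T hT' => ?_, fun η hη t ht => ?_⟩
  · exact h.continuousOn.comp (by fun_prop) fun t ht => by
      have : (0 : ℝ) ≤ t := ht
      exact (by linarith : (0 : ℝ) ≤ t + 1 / a)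
  · simpa using (hyi T hT').comp_add_right (1 / a)
  · have hmi : ∀ p q, 0 ≤ p → 0 ≤ q → IntervalIntegrable (fun s => mass (w s)) volume p q :=
      fun p q hp hq => ContinuousOn.intervalIntegrable
        ((continuousOn_mass h.continuousOn).mono fun x hx => (le_min hp hq).trans hx.1)
    have hηc := hη.continuous
    set F : ℝ → ℝ := fun s => (k * y s + κ * mass (w s)) * η (-(a * s) + 1)
      - y s * η (1 - a * s + 1) with hF
    have hFi : ∀ p q, 0 ≤ p → 0 ≤ q → IntervalIntegrable F volume p q := by
      intro p q hp hq
      have hpq : IntervalIntegrable y volume p q :=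
        (h.intervalIntegrable p hp).symm.trans (h.intervalIntegrable q hq)
      exact (((hpq.const_mul k).add ((hmi p q hp hq).const_mul κ)).mul_continuousOn
        (by fun_prop)).sub (hpq.mul_continuousOn (by fun_prop))
    -- A delay of `1/a` moves the characteristics by one, which the argument `ξ + 1` compensates;
    -- the state at time `1/a` is zero, so the integral up to `1/a` drops out.
    have h1 := h.pairing_eq (fun ξ => η (ξ + 1)) (by fun_prop) (t + 1 / a) (by linarith)
    have h2 := h.pairing_eq (fun ξ => η (ξ + 1)) (by fun_prop) (1 / a) hT.le
    have h0 : pairing (w (1 / a)) (fun x => η (x - a * (1 / a) + 1)) = 0 := by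
      rw [h.eq_zero_of_le ha (1 / a) ⟨hT.le, le_rfl⟩, pairing_eq_inner _ (by fun_prop),
        inner_zero_right]
    rw [h0] at h2
    have haT : a * (1 / a) = 1 := mul_one_div_cancel ha.ne'
    have e1 : ∀ x, x - a * (t + 1 / a) + 1 = x - a * t := fun x => by rw [mul_add, haT]; ring
    simp only [e1] at h1
    have h3 : ∫ s in (1 / a)..(t + 1 / a), F s
        = (∫ s in (0 : ℝ)..(t + 1 / a), F s) - ∫ s in (0 : ℝ)..(1 / a), F s :=
      (intervalIntegral.integral_interval_sub_left (hFi _ _ le_rfl (by linarith))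
        (hFi _ _ le_rfl hT.le)).symm
    rw [h1]
    have h4 := intervalIntegral.integral_comp_add_right (a := 0) (b := t) F (1 / a)
    rw [zero_add, h3] at h4
    have h5 : ∫ s in (0 : ℝ)..(1 / a), F s = 0 := h2.symm
    rw [h5, sub_zero] at h4
    rw [← h4]
    refine intervalIntegral.integral_congr fun s _ => ?_
    have e2 : -(a * (s + 1 / a)) + 1 = -(a * s) := by rw [mul_add, haT]; ring
    have e3 : 1 - a * (s + 1 / a) + 1 = 1 - a * s := by rw [mul_add, haT]; ring
    simp only [hF, e2, e3]

theorem eq_zero (h : IsNullSolution a k κ w y) (ha : 0 < a) {t : ℝ} (ht : 0 ≤ t) : w t = 0 := by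
  have hT : 0 < 1 / a := by positivity
  have key : ∀ n : ℕ, ∀ w y, IsNullSolution a k κ w y → ∀ t ∈ Icc 0 (n * (1 / a)), w t = 0 := by
    intro n
    induction n with
    | zero =>
      intro w y h t ht
      exact h.eq_zero_of_le ha t ⟨ht.1, ht.2.trans (by simpa using ha.le)⟩
    | succ n ih =>
      intro w y h t ht
      rcases le_total t (1 / a) with h1 | h1
      · exact h.eq_zero_of_le ha t ⟨ht.1, h1⟩
      · have h2 : t ≤ n * (1 / a) + 1 / a := by
          have := ht.2
          push_cast at this
          linarith
        have := ih _ _ (h.shift ha) (t - 1 / a) ⟨by linarith, by linarith⟩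
        simpa using this
  obtain ⟨n, hn⟩ := exists_nat_ge (t / (1 / a))
  rw [div_le_iff₀ hT] at hn
  exact key n w y h t ⟨ht, hn⟩

end IsNullSolution

/-- By linearity the difference is a null solution, with the difference of the two possibly distinct
outfluxes as its outflux. -/
theorem IsWeakSolution.unique {vel : ℝ → ℝ} {rhobar : ℝ} (hpos : 0 < vel rhobar) {ρ₀ : L2}
    {ρ σ : ℝ → L2} (hρ : IsWeakSolution vel rhobar k ρ₀ ρ)
    (hσ : IsWeakSolution vel rhobar k ρ₀ σ) {t : ℝ} (ht : 0 ≤ t) : σ t = ρ t := by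
  obtain ⟨hρc, y, hy, hρw⟩ := hρ
  obtain ⟨hσc, z, hz, hσw⟩ := hσ
  have hi : ∀ {y : ℝ → ℝ}, (∀ T : ℝ, 0 < T → MemLp y 2 (volume.restrict (Ioo 0 T))) →
      ∀ T, 0 ≤ T → IntervalIntegrable y volume 0 T := by
    intro y hy T hT
    rcases hT.eq_or_lt with rfl | hT'
    · exact IntervalIntegrable.refl
    · exact intervalIntegrable_of_memLp hT (hy T hT')
  set κ := (k - 1) * dParam vel rhobar * vel rhobar with hκ
  have hnull : IsNullSolution (vel rhobar) k κ (fun t => σ t - ρ t) (fun t => z t - y t) := by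
    refine ⟨hσc.sub hρc, fun T hT => (hi hz T hT).sub (hi hy T hT), fun η hη t ht => ?_⟩
    have hηc := hη.continuous
    have hFi : ∀ {ρ : ℝ → L2} {y : ℝ → ℝ}, ContinuousOn ρ (Ici 0) →
        (∀ T : ℝ, 0 < T → MemLp y 2 (volume.restrict (Ioo 0 T))) →
        IntervalIntegrable (fun s => (k * y s + κ * mass (ρ s)) * η (-(vel rhobar * s))
          - y s * η (1 - vel rhobar * s)) volume 0 t := by
      intro ρ y hρ hy
      have hmi : IntervalIntegrable (fun s => mass (ρ s)) volume 0 t :=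
        ContinuousOn.intervalIntegrable ((continuousOn_mass hρ).mono fun x hx =>
          (le_min le_rfl ht).trans hx.1)
      exact ((((hi hy t ht).const_mul k).add (hmi.const_mul κ)).mul_continuousOn
        (by fun_prop)).sub ((hi hy t ht).mul_continuousOn (by fun_prop))
    rw [pairing_sub _ _ (by fun_prop), pairing_weakSolution hσc hz hσw hη ht,
      pairing_weakSolution hρc hy hρw hη ht, add_sub_add_left_eq_sub,
      ← intervalIntegral.integral_sub (hFi hσc hz) (hFi hρc hy)]
    refine intervalIntegral.integral_congr fun s _ => ?_
    simp only [mass_eq_pairing, pairing_sub _ _ continuous_const]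
    ring
  exact sub_eq_zero.1 (hnull.eq_zero hpos ht)

end

/-! ### Exponential stability: the two implications -/

section

variable {k : ℝ}

theorem integral_sq_history {c : ℝ} (f : ℝ → ℝ) (n : ℕ) :
    ∫ t in (n : ℝ)..(n + 1), history c k f t ^ 2 = normSq ((step c k)^[n] f) := by
  have := integral_history_comp (c := c) (k := k) (f := f) (fun v => v ^ 2) n
    (le_refl (0 : ℝ)) zero_le_one le_rfl
  rwa [add_zero] at this

theorem exponentiallyStable_of_lt {vel : ℝ → ℝ} {rhobar : ℝ} (hpos : 0 < vel rhobar)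
    (hd : -1 < dParam vel rhobar) (hk : |k| < 1) : ExponentiallyStable vel rhobar k := by
  obtain ⟨C, q, hC, hq0, hq1, hdecay⟩ := exists_normSq_iterate_step_le hd hk
  set a := vel rhobar with ha
  have hlog : Real.log q < 0 := Real.log_neg hq0 hq1
  refine ⟨Real.sqrt (2 * C / q), by positivity, -(a * Real.log q) / 2, ?_, fun ρ₀ ρ hρ t ht => ?_⟩
  · have : a * Real.log q < 0 := mul_neg_of_pos_of_neg hpos hlog
    linarith
  rw [(isWeakSolution_solution hpos k ρ₀).unique hpos hρ ht]
  have hf := locallySquareIntegrable_initialInflux ρ₀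
  set c := (1 - k) * dParam vel rhobar with hc
  set V := history c k (initialInflux ρ₀) with hV
  have hVl : LocallySquareIntegrable V := hf.history
  have hat : 0 ≤ a * t := mul_nonneg hpos.le ht
  set n := ⌊a * t⌋₊ with hn
  have hn1 : (n : ℝ) ≤ a * t := Nat.floor_le hat
  have hn2 : a * t < n + 1 := Nat.lt_floor_add_one _
  -- The window `[a t, a t + 1]` lies in the two transits `[n, n+2]`.
  have h1 : ‖solution vel rhobar k ρ₀ t‖ ^ 2 ≤ ∫ s in (n : ℝ)..(n + 2), V s ^ 2 := by
    rw [solution, norm_sq_profile]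
    exact intervalIntegral.integral_mono_interval hn1 (by linarith) (by linarith)
      (Filter.Eventually.of_forall fun _ => sq_nonneg _) (hVl.intervalIntegrable_sq _ _)
  have h2 : ∫ s in (n : ℝ)..(n + 2), V s ^ 2
      = normSq ((step c k)^[n] (initialInflux ρ₀))
        + normSq ((step c k)^[n + 1] (initialInflux ρ₀)) := by
    rw [← integral_sq_history, ← integral_sq_history,
      show ((n + 1 : ℕ) : ℝ) = n + 1 by push_cast; ring,
      show (n : ℝ) + 1 + 1 = n + 2 by ring]
    exact (intervalIntegral.integral_add_adjacent_intervals (hVl.intervalIntegrable_sq _ _)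
      (hVl.intervalIntegrable_sq _ _)).symm
  have h3 := hdecay _ hf n
  have h4 := hdecay _ hf (n + 1)
  rw [normSq_initialInflux] at h3 h4
  -- As `q < 1` and `a t < n + 1`, `q ^ (n+1) ≤ q ^ (a t)`; this costs the factor `1/q` in the
  -- constant, and the square root halves the rate.
  have h5 : q ^ n ≤ Real.exp (a * t * Real.log q) / q := by
    rw [le_div_iff₀ hq0, ← pow_succ, ← Real.rpow_natCast, Real.rpow_def_of_pos hq0,
      Real.exp_le_exp, mul_comm]
    refine mul_le_mul_of_nonpos_right ?_ hlog.le
    push_cast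
    exact hn2.le
  have h6 : ‖solution vel rhobar k ρ₀ t‖ ^ 2
      ≤ 2 * C / q * Real.exp (a * t * Real.log q) * ‖ρ₀‖ ^ 2 := by
    have hs : q ^ (n + 1) ≤ q ^ n := pow_le_pow_of_le_one hq0.le hq1.le (Nat.le_succ n)
    calc ‖solution vel rhobar k ρ₀ t‖ ^ 2 ≤ C * q ^ n * ‖ρ₀‖ ^ 2 + C * q ^ (n + 1) * ‖ρ₀‖ ^ 2 := by
          linarith
      _ ≤ C * q ^ n * ‖ρ₀‖ ^ 2 + C * q ^ n * ‖ρ₀‖ ^ 2 := by gcongr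
      _ = 2 * C * q ^ n * ‖ρ₀‖ ^ 2 := by ring
      _ ≤ 2 * C * (Real.exp (a * t * Real.log q) / q) * ‖ρ₀‖ ^ 2 := by gcongr
      _ = _ := by ring
  refine (sq_le_sq₀ (norm_nonneg _) (by positivity)).1 (h6.trans (le_of_eq ?_))
  rw [mul_pow, mul_pow, Real.sq_sqrt (by positivity), ← Real.exp_nat_mul]
  congr 3
  push_cast
  ring

/-- At time `n / a` the squared norm is exactly that of the `n`-th iterate. Exponential decay would
push it below `r` for large `n`, uniformly over data in the unit ball, so the datum may be chosen
after `n`. -/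
theorem lt_of_exponentiallyStable {vel : ℝ → ℝ} {rhobar : ℝ} (hpos : 0 < vel rhobar)
    (h : ExponentiallyStable vel rhobar k) : -1 < dParam vel rhobar ∧ |k| < 1 := by
  by_contra hcon
  obtain ⟨r, hr, hgrow⟩ := exists_normSq_iterate_step_ge hcon
  obtain ⟨C, hC, α, hα, hstab⟩ := h
  set a := vel rhobar with ha
  have hlim : Filter.Tendsto (fun n : ℕ => (C * Real.exp (-α * (n / a))) ^ 2) Filter.atTop
      (nhds ((C * 0) ^ 2)) := by
    refine ((Real.tendsto_exp_atBot.comp ?_).const_mul C).pow 2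
    exact (tendsto_natCast_atTop_atTop.atTop_div_const hpos).const_mul_atTop_of_neg
      (by linarith)
  obtain ⟨n, hn⟩ := (hlim.eventually_lt_const (u := r) (by simpa using hr)).exists
  obtain ⟨f, hfc, hf1, hfr⟩ := hgrow n
  have hf : LocallySquareIntegrable f := .of_continuous hfc
  have hV := hf.history (c := (1 - k) * dParam vel rhobar) (k := k)
  have hsol : IsWeakSolution vel rhobar k (profile hV a 0) (profile hV a) :=
    isWeakSolution_profile hpos hV (fun s hs => history_add_one hf hs) (by
      filter_upwards [coeFn_profile hV a 0] with x hx
      rw [hx, mul_zero, zero_add])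
  have hb := hstab _ _ hsol (n / a) (by positivity)
  have h0 : ‖profile hV a 0‖ ^ 2 ≤ 1 := by
    have := integral_sq_history (c := (1 - k) * dParam vel rhobar) (k := k) f 0
    rw [norm_sq_profile, mul_zero]
    simp only [Nat.cast_zero, Function.iterate_zero, id] at this
    rwa [this]
  have h1 : r ≤ ‖profile hV a (n / a)‖ ^ 2 := by
    rw [norm_sq_profile, mul_div_cancel₀ _ hpos.ne', integral_sq_history]
    exact hfr
  have h2 : ‖profile hV a (n / a)‖ ^ 2
      ≤ (C * Real.exp (-α * (n / a))) ^ 2 * ‖profile hV a 0‖ ^ 2 := by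
    rw [← mul_pow]
    exact pow_le_pow_left₀ (norm_nonneg _) hb 2
  have h3 : (C * Real.exp (-α * (n / a))) ^ 2 * ‖profile hV a 0‖ ^ 2
      ≤ (C * Real.exp (-α * (n / a))) ^ 2 := mul_le_of_le_one_right (sq_nonneg _) h0
  linarith

end

end ReentrantFlow

end

theorem theorem3p1 (vel : ℝ → ℝ) (hvel : ContDiff ℝ 1 vel) (hpos : ∀ s : ℝ, 0 < vel s)
    (rhobar k : ℝ) :
    (∀ ρ₀ : ReentrantFlow.L2, ∃ ρ : ℝ → ReentrantFlow.L2,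
        ReentrantFlow.IsWeakSolution vel rhobar k ρ₀ ρ ∧
        ∀ σ : ℝ → ReentrantFlow.L2, ReentrantFlow.IsWeakSolution vel rhobar k ρ₀ σ →
          ∀ t : ℝ, 0 ≤ t → σ t = ρ t) ∧
    (ReentrantFlow.ExponentiallyStable vel rhobar k ↔
      -1 < ReentrantFlow.dParam vel rhobar ∧ |k| < 1) :=
  ⟨fun ρ₀ => ⟨ReentrantFlow.solution vel rhobar k ρ₀,
      ReentrantFlow.isWeakSolution_solution (hpos rhobar) k ρ₀, fun _ hσ _ ht =>
        (ReentrantFlow.isWeakSolution_solution (hpos rhobar) k ρ₀).unique (hpos rhobar) hσ ht⟩,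
    ReentrantFlow.lt_of_exponentiallyStable (hpos rhobar), fun h =>
      ReentrantFlow.exponentiallyStable_of_lt (hpos rhobar) h.1 h.2⟩
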